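/- There are a constant $C$ and a polynomial-time algorithm with the following property. The input is a pair $(P,D)$, where $P\subseteq\mathbb Z^2$ is a finite set of $n$ points, no two of them in the same row (points may share columns), and $D\subseteq P\times P$ is a set of demands that forms a complete $k$-partite graph for some $k$ (arbitrary, depending on the input): $P$ is a disjoint union $S_1\cup\dots\cup S_k$, and for all $p,q\in P$ one of $(p,q),(q,p)$ belongs to $D$ if and only if $p$ and $q$ lie in different parts. The output is a finite set $Q\subseteq\mathbb Z^2$ that is feasible for $(P,D)$ and satisfies $$|Q|\le C\cdot\max\{1,\log\log n\}\cdot \mathrm{opt}(P,D)$$ (where $\max\{1,\log\log n\}$ is read as $1$ for $n\le 1$). Here a finite set $Q\subseteq\mathbb R^2$ is feasible for $(P,D)$ if for every $(p,q)\in D$ there is a sequence $p=x_0,x_1,\dots,x_m=q$ of points of $P\cup Q$ in which any two consecutive points lie on a common horizontal or vertical line and $\sum_{i<m}\|x_i-x_{i+1}\|_1=\|p-q\|_1$; and $\mathrm{opt}(P,D)$ is the minimum cardinality of a feasible finite set $Q\subseteq\mathbb R^2$. In other words, MinGMConn with complete $k$-partite demands has an $O(\log\log n)$-approximation algorithm.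 Running time is measured on programs over binary trees with integer leaves under the logarithmic cost criterion, and is polynomial in the number of bits of the input. -/

import Mathlib

namespace Manhattan

/-! ### Minimum generalized Manhattan connections -/

/-- The `ℓ₁`-distance of two points of the plane. -/
def dist1 (p q : ℝ × ℝ) : ℝ := |p.1 - q.1| + |p.2 - q.2|

/-- Two points are aligned if they lie on a common vertical or horizontal line. -/
def Aligned (p q : ℝ × ℝ) : Prop := p.1 = q.1 ∨ p.2 = q.2

/-- `p` and `q` are Manhattan-connected in `X`: some sequence `p = v 0, v 1, …, v m = q` of points
of `X`, with consecutive points aligned, has total length `‖p - q‖₁`. -/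
def MConnected (X : Set (ℝ × ℝ)) (p q : ℝ × ℝ) : Prop :=
  ∃ (m : ℕ) (v : ℕ → ℝ × ℝ), v 0 = p ∧ v m = q ∧ (∀ i ≤ m, v i ∈ X) ∧
    (∀ i < m, Aligned (v i) (v (i + 1))) ∧
    ∑ i ∈ Finset.range m, dist1 (v i) (v (i + 1)) = dist1 p q

/-- A point of the integer grid. -/
abbrev GridPoint : Type := ℤ × ℤ

/-- The position of a grid point in the plane. -/
def GridPoint.toPlane (p : GridPoint) : ℝ × ℝ := ((p.1 : ℝ), (p.2 : ℝ))

/-- An instance `(P, D)`: a list of grid points, no two of them in the same row (columns may be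
shared), and a list of demands between these points. -/
structure Instance where
  points : List GridPoint
  demands : List (GridPoint × GridPoint)
  distinct_rows : (points.map Prod.snd).Nodup
  demands_mem : ∀ d ∈ demands, d.1 ∈ points ∧ d.2 ∈ points

/-- `Q` is a feasible solution of `I = (P, D)`: all demands are connected in `P ∪ Q`. -/
def Instance.Feasible (I : Instance) (Q : Finset (ℝ × ℝ)) : Prop :=
  ∀ d ∈ I.demands,
    MConnected ({x | ∃ p ∈ I.points, p.toPlane = x} ∪ (Q : Set (ℝ × ℝ))) d.1.toPlane d.2.toPlane

/-- The minimum cardinality of a feasible solution in the plane. -/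
noncomputable def Instance.opt (I : Instance) : ℕ :=
  sInf {m | ∃ Q : Finset (ℝ × ℝ), I.Feasible Q ∧ Q.card = m}

/-- The set over which `opt` takes the infimum is not empty. -/
theorem Instance.exists_feasible (I : Instance) : ∃ Q : Finset (ℝ × ℝ), I.Feasible Q := by
  classical
  refine ⟨(I.demands.map fun d => ((d.1.1 : ℝ), (d.2.2 : ℝ))).toFinset, fun d hd => ?_⟩
  refine ⟨2, fun i => if i = 0 then d.1.toPlane else
    if i = 1 then ((d.1.1 : ℝ), (d.2.2 : ℝ)) else d.2.toPlane, by simp, by simp, ?_, ?_, ?_⟩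
  · intro i hi
    have h := I.demands_mem d hd
    interval_cases i
    · exact Or.inl ⟨d.1, h.1, by simp⟩
    · refine Or.inr ?_
      simp only [List.coe_toFinset, List.mem_map, Set.mem_ofPred_eq]
      exact ⟨d, hd, by simp⟩
    · exact Or.inl ⟨d.2, h.2, by simp⟩
  · intro i hi
    interval_cases i <;> simp [Aligned, GridPoint.toPlane]
  · simp [Finset.sum_range_succ, dist1, GridPoint.toPlane, add_comm]

/-- The demands form a complete `k`-partite graph: the points are partitioned into `S₁, …, S_k`,
and two points form a demand (in some order) exactly if they lie in different parts. -/
def Instance.IsCompletePartite (I : Instance) (k : ℕ) : Prop :=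
  ∃ S : Fin k → Set GridPoint,
    (∀ i j, i ≠ j → Disjoint (S i) (S j)) ∧
    (∀ p, p ∈ I.points ↔ ∃ i, p ∈ S i) ∧
    ∀ p q, ((p, q) ∈ I.demands ∨ (q, p) ∈ I.demands) ↔ ∃ i j, i ≠ j ∧ p ∈ S i ∧ q ∈ S j

/-! ### Algorithms and their running time

Programs work on binary trees with integer leaves. Every step is charged for the number of bits of
the data that it handles (logarithmic cost), so that running times agree with those of Turing
machines up to a polynomial. -/

/-- Binary trees with integer leaves. -/
inductive Data where
  | int (z : ℤ) : Data
  | pair (a b : Data) : Data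

/-- The number of bits of a tree, up to a constant factor. -/
def Data.size : Data → ℕ
  | .int z => 1 + z.natAbs.size
  | .pair a b => 1 + a.size + b.size

/-- The elementary operations. -/
inductive Prim where
  | id : Prim
  | const (d : Data) : Prim
  | fst : Prim
  | snd : Prim
  | isPair : Prim
  | le : Prim
  | add : Prim
  | sub : Prim

/-- The value of an elementary operation. The truth values are `0` and `1`; an operation that is
applied to data of the wrong shape returns `0`. -/
def Prim.eval : Prim → Data → Data
  | .id, x => x
  | .const d, _ => d
  | .fst, .pair a _ => a
  | .snd, .pair _ b => b
  | .isPair, .pair _ _ => .int 1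
  | .le, .pair (.int a) (.int b) => if a ≤ b then .int 1 else .int 0
  | .add, .pair (.int a) (.int b) => .int (a + b)
  | .sub, .pair (.int a) (.int b) => .int (a - b)
  | _, _ => .int 0

/-- Programs: elementary operations, sequencing `f; g`, running `f` and `g` on copies of the same
data and pairing the results, branching, and the loop `while c do f`. -/
inductive Program where
  | prim (o : Prim) : Program
  | seq (f g : Program) : Program
  | fork (f g : Program) : Program
  | ite (c f g : Program) : Program
  | loop (c f : Program) : Program

/-- `Runs A x y t`: on input `x` the program `A` halts with output `y` after time `t`.
A test counts as passed if its result is not the integer `0`. -/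
inductive Runs : Program → Data → Data → ℕ → Prop where
  | prim (o : Prim) (x : Data) : Runs (.prim o) x (o.eval x) (1 + x.size + (o.eval x).size)
  | seq {f g : Program} {x y z : Data} {s t : ℕ} :
      Runs f x y s → Runs g y z t → Runs (.seq f g) x z (s + t + 1)
  | fork {f g : Program} {x y z : Data} {s t : ℕ} :
      Runs f x y s → Runs g x z t → Runs (.fork f g) x (.pair y z) (s + t + 1 + x.size)
  | ite_true {c f g : Program} {x b y : Data} {s t : ℕ} :
      Runs c x b s → b ≠ .int 0 → Runs f x y t → Runs (.ite c f g) x y (s + t + 1 + x.size)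
  | ite_false {c f g : Program} {x y : Data} {s t : ℕ} :
      Runs c x (.int 0) s → Runs g x y t → Runs (.ite c f g) x y (s + t + 1 + x.size)
  | loop_stop {c f : Program} {x : Data} {s : ℕ} :
      Runs c x (.int 0) s → Runs (.loop c f) x x (s + 1 + x.size)
  | loop_step {c f : Program} {x b y z : Data} {s t u : ℕ} :
      Runs c x b s → b ≠ .int 0 → Runs f x y t → Runs (.loop c f) y z u →
      Runs (.loop c f) x z (s + t + u + 1 + x.size)

/-- Pairs and lists as trees; the empty list is `0`. -/
def encodePoint (p : GridPoint) : Data := .pair (.int p.1) (.int p.2)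

def encodeDemand (d : GridPoint × GridPoint) : Data := .pair (encodePoint d.1) (encodePoint d.2)

def encodeList {α : Type} (e : α → Data) : List α → Data
  | [] => .int 0
  | a :: l => .pair (e a) (encodeList e l)

def Instance.encode (I : Instance) : Data :=
  .pair (encodeList encodePoint I.points) (encodeList encodeDemand I.demands)

/-- `A` is a polynomial-time `ρ`-approximation algorithm on the instances that satisfy `K`: in time
polynomial in the size of the input it outputs (a list of the elements of) a feasible solution with
at most `ρ(n) · opt` points, where `n` is the number of input points. -/
def IsApproxAlgorithm (A : Program) (K : Instance → Prop) (ρ : ℕ → ℝ) : Prop :=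
  ∃ p : Polynomial ℕ, ∀ I : Instance, K I →
    ∃ (Q : List GridPoint) (t : ℕ),
      Runs A I.encode (encodeList encodePoint Q) t ∧
      t ≤ p.eval I.encode.size ∧
      I.Feasible (Q.map GridPoint.toPlane).toFinset ∧
      ((Q.map GridPoint.toPlane).toFinset.card : ℝ) ≤ ρ I.points.length * (I.opt : ℝ)

end Manhattan

namespace Manhattan

/-! ### Polynomial-time functions between encoded types -/

/-! Rank each column by the number of points to its left; the blocks of height `s` group columns
with equal `rank / 2 ^ s`. Heights run up to `H`, roughly `2 * log₂ n`. Level `k` cuts them into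
intervals from `lo = i * 2 ^ k` to `hi = (i + 1) * 2 ^ k`, so only `H.size = O(log log n)` levels
are nonempty. It suffices that each level contributes `O(opt)` points and that all levels together
connect every demand.

For a block of height `lo`, a crossing pair consists of two differently coloured points of the
surrounding block of height `hi`, exactly one of them in the small block. Crossing pairs that end as
early as possible in row order define keys (`Layout.UpKeyAt`). The output consists of the
projections of all keys to the boundary columns of their blocks, at height `lo` and at the midpoint
of the interval, together with the same points for the instance reflected in a horizontal line.

Lower bound (`Layout.card_keys_le`): the keys of one level fall into eight classes, by the side of
the upper end, by `OneSided`, and by whether the outer end is to the left or right. Within a class,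
the pairs belonging to one block have disjoint row ranges (`UpKeyAt.separated`). A Manhattan path
for such a pair crosses the block boundary in a gap between consecutive points of a row of `P ∪ Q`.
The gap determines the pair, because intervals of one level do not overlap, and one end of it is in
`Q`, because `P` has at most one point per row. So a class has at most `2 * |Q|` keys
(`Layout.card_le_of_separated`).

Feasibility (`Layout.exists_upPath`): let `p` be below and to the left of `q`, and let `d + 1` be
the least height at which they share a block. With decreasing `k`, narrow the interval around `d`.
Whenever `d` lies in the upper half, `State.exists_upKey` supplies a key; the path climbs to its row
and moves right to the end of the block of midpoint height. It thus reaches the last column of the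
block of height `d`. The same construction runs from `q` after a half turn, and one key of level `0`
joins the two paths. The multipartite structure enters through transitivity of "same colour", both
here and in the lower bound.

The algorithm is built from folds over lists, whose polynomial running time follows from closure
properties of `PTime`. -/

theorem polynomial_eval_mono (p : Polynomial ℕ) {m n : ℕ} (h : m ≤ n) : p.eval m ≤ p.eval n := by
  rw [Polynomial.eval_eq_sum, Polynomial.eval_eq_sum]
  exact Finset.sum_le_sum fun i _ => Nat.mul_le_mul_left _ (Nat.pow_le_pow_left h i)

/-- Types whose elements are encoded as trees. -/
class Enc (α : Type) where
  enc : α → Data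

open Enc (enc)

instance : Enc ℤ := ⟨.int⟩

instance : Enc Bool := ⟨fun b => .int (if b then 1 else 0)⟩

instance {α β : Type} [Enc α] [Enc β] : Enc (α × β) := ⟨fun p => .pair (enc p.1) (enc p.2)⟩

instance {α : Type} [Enc α] : Enc (List α) := ⟨encodeList enc⟩

/-- The size of the encoding. -/
def sz {α : Type} [Enc α] (a : α) : ℕ := (enc a).size

section

variable {α β γ E : Type} [Enc α] [Enc β] [Enc γ] [Enc E]

theorem sz_pair (p : α × β) : sz p = 1 + sz p.1 + sz p.2 := rfl

theorem sz_nil : sz ([] : List α) = 1 := by simp [sz, enc, encodeList, Data.size]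

theorem sz_cons (a : α) (l : List α) : sz (a :: l) = 1 + sz a + sz l := rfl

theorem sz_bool (b : Bool) : sz b ≤ 2 := by
  cases b <;> simp [sz, enc, Data.size]

theorem sz_int (z : ℤ) : sz z = 1 + z.natAbs.size := rfl

theorem length_le_sz (l : List α) : l.length ≤ sz l := by
  induction l with
  | nil => simp
  | cons a l ih => rw [sz_cons, List.length_cons]; omega

theorem sz_le_of_mem {a : α} {l : List α} (h : a ∈ l) : sz a ≤ sz l := by
  induction l with
  | nil => simp at h
  | cons b l ih =>
    rw [sz_cons]
    rcases List.mem_cons.1 h with rfl | h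
    · omega
    · have := ih h; omega

theorem sz_le_of_forall {l : List α} {B : ℕ} (h : ∀ a ∈ l, sz a ≤ B) :
    sz l ≤ 1 + l.length * (1 + B) := by
  induction l with
  | nil => simp [sz_nil]
  | cons b l ih =>
    have h1 := ih fun a ha => h a (List.mem_cons_of_mem _ ha)
    have h2 := h b (by simp)
    rw [sz_cons, List.length_cons, Nat.succ_mul]
    omega

/-- Each elementary operation pays for its output. Hence a time bound is also a size bound, which is
what makes polynomial time closed under composition. -/
theorem Runs.size_le {A : Program} {x y : Data} {t : ℕ} (h : Runs A x y t) : y.size ≤ t := by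
  induction h <;> (try simp only [Data.size]) <;> omega

/-- `f` is computed by some program in time polynomial in the size of the input. -/
def PTime (f : α → β) : Prop :=
  ∃ (A : Program) (p : Polynomial ℕ), ∀ a, ∃ t, Runs A (enc a) (enc (f a)) t ∧ t ≤ p.eval (sz a)

theorem PTime.size_le {f : α → β} (hf : PTime f) :
    ∃ p : Polynomial ℕ, ∀ a, sz (f a) ≤ p.eval (sz a) := by
  obtain ⟨A, p, h⟩ := hf
  refine ⟨p, fun a => ?_⟩
  obtain ⟨t, ht, hp⟩ := h a
  exact ht.size_le.trans hp

theorem PTime.of_eq {f g : α → β} (hf : PTime f) (h : ∀ a, f a = g a) : PTime g := by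
  rwa [← funext h]

theorem PTime.of_prim {f : α → β} (o : Prim) (p : Polynomial ℕ)
    (h : ∀ a, o.eval (enc a) = enc (f a)) (hp : ∀ a, sz (f a) ≤ p.eval (sz a)) : PTime f := by
  refine ⟨.prim o, 1 + Polynomial.X + p, fun a => ⟨_, h a ▸ Runs.prim o (enc a), ?_⟩⟩
  have := hp a
  simp only [Polynomial.eval_add, Polynomial.eval_one, Polynomial.eval_X]
  unfold sz at *
  omega

theorem PTime.id : PTime (fun a : α => a) :=
  .of_prim .id .X (fun _ => rfl) (by simp)

theorem PTime.const (b : β) : PTime (fun _ : α => b) :=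
  .of_prim (.const (enc b)) (.C (sz b)) (fun _ => rfl) (by simp)

theorem PTime.comp {f : β → γ} {g : α → β} (hf : PTime f) (hg : PTime g) :
    PTime (fun a => f (g a)) := by
  obtain ⟨A, p, hA⟩ := hf
  obtain ⟨B, q, hB⟩ := hg
  refine ⟨.seq B A, q + p.comp q + 1, fun a => ?_⟩
  obtain ⟨s, hs, hsq⟩ := hB a
  obtain ⟨t, ht, htp⟩ := hA (g a)
  refine ⟨_, .seq hs ht, ?_⟩
  have := polynomial_eval_mono p (hs.size_le.trans hsq)
  simp only [Polynomial.eval_add, Polynomial.eval_one, Polynomial.eval_comp]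
  unfold sz at *
  omega

theorem PTime.fst' : PTime (fun p : α × β => p.1) :=
  .of_prim .fst .X (fun _ => rfl) (fun p => by rw [Polynomial.eval_X, sz_pair]; omega)

theorem PTime.snd' : PTime (fun p : α × β => p.2) :=
  .of_prim .snd .X (fun _ => rfl) (fun p => by rw [Polynomial.eval_X, sz_pair]; omega)

theorem PTime.fst {f : γ → α × β} (hf : PTime f) : PTime (fun a => (f a).1) := PTime.fst'.comp hf

theorem PTime.snd {f : γ → α × β} (hf : PTime f) : PTime (fun a => (f a).2) := PTime.snd'.comp hf

theorem PTime.pair {f : γ → α} {g : γ → β} (hf : PTime f) (hg : PTime g) :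
    PTime (fun a => (f a, g a)) := by
  obtain ⟨A, p, hA⟩ := hf
  obtain ⟨B, q, hB⟩ := hg
  refine ⟨.fork A B, p + q + 1 + .X, fun a => ?_⟩
  obtain ⟨s, hs, hsq⟩ := hA a
  obtain ⟨t, ht, htp⟩ := hB a
  refine ⟨_, .fork hs ht, ?_⟩
  simp only [Polynomial.eval_add, Polynomial.eval_one, Polynomial.eval_X]
  unfold sz at *
  omega

theorem PTime.cond {c : γ → Bool} {f g : γ → α} (hc : PTime c) (hf : PTime f) (hg : PTime g) :
    PTime (fun a => bif c a then f a else g a) := by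
  obtain ⟨C, r, hC⟩ := hc
  obtain ⟨A, p, hA⟩ := hf
  obtain ⟨B, q, hB⟩ := hg
  refine ⟨.ite C A B, r + p + q + 1 + .X, fun a => ?_⟩
  obtain ⟨u, hu, hur⟩ := hC a
  obtain ⟨s, hs, hsq⟩ := hA a
  obtain ⟨t, ht, htp⟩ := hB a
  simp only [Polynomial.eval_add, Polynomial.eval_one, Polynomial.eval_X]
  cases h : c a
  · rw [h] at hu
    refine ⟨_, .ite_false hu ht, ?_⟩
    unfold sz at *
    omega
  · rw [h] at hu
    refine ⟨_, .ite_true hu (by simp [enc]) hs, ?_⟩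
    unfold sz at *
    omega

theorem PTime.not {f : γ → Bool} (hf : PTime f) : PTime (fun a => !f a) :=
  (hf.cond (.const false) (.const true)).of_eq fun a => by cases f a <;> rfl

theorem PTime.and {f g : γ → Bool} (hf : PTime f) (hg : PTime g) : PTime (fun a => f a && g a) :=
  (hf.cond hg (.const false)).of_eq fun a => by cases f a <;> rfl

theorem PTime.or {f g : γ → Bool} (hf : PTime f) (hg : PTime g) : PTime (fun a => f a || g a) :=
  (hf.cond (.const true) hg).of_eq fun a => by cases f a <;> rfl

theorem PTime.beq_bool {f g : γ → Bool} (hf : PTime f) (hg : PTime g) :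
    PTime (fun a => f a == g a) :=
  (hf.cond hg hg.not).of_eq fun a => by cases f a <;> cases g a <;> rfl

theorem PTime.le {f g : γ → ℤ} (hf : PTime f) (hg : PTime g) :
    PTime (fun a => decide (f a ≤ g a)) := by
  refine PTime.comp (f := fun p : ℤ × ℤ => decide (p.1 ≤ p.2)) ?_ (hf.pair hg)
  refine .of_prim .le (.C 2) (fun p => ?_) (fun p => by simpa using sz_bool _)
  by_cases h : p.1 ≤ p.2 <;> simp [enc, Prim.eval, h]

theorem PTime.lt {f g : γ → ℤ} (hf : PTime f) (hg : PTime g) :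
    PTime (fun a => decide (f a < g a)) :=
  (hg.le hf).not.of_eq fun a => by rw [← decide_not]; simp

theorem PTime.eq_int {f g : γ → ℤ} (hf : PTime f) (hg : PTime g) :
    PTime (fun a => decide (f a = g a)) :=
  ((hf.le hg).and (hg.le hf)).of_eq fun a => by
    rw [← Bool.decide_and]; exact decide_eq_decide.2 le_antisymm_iff.symm

theorem sz_add_le (a b : ℤ) : sz (a + b) ≤ 1 + sz a + sz b := by
  simp only [sz_int]
  have : (a + b).natAbs.size ≤ a.natAbs.size + b.natAbs.size + 1 := by
    refine Nat.size_le.2 ?_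
    have h1 := Nat.lt_size_self a.natAbs
    have h2 := Nat.lt_size_self b.natAbs
    have h3 := Int.natAbs_add_le a b
    have h4 : 2 ^ a.natAbs.size ≤ 2 ^ (a.natAbs.size + b.natAbs.size) :=
      Nat.pow_le_pow_right (by norm_num) (by omega)
    have h5 : 2 ^ b.natAbs.size ≤ 2 ^ (a.natAbs.size + b.natAbs.size) :=
      Nat.pow_le_pow_right (by norm_num) (by omega)
    rw [pow_succ]
    omega
  omega

theorem PTime.add {f g : γ → ℤ} (hf : PTime f) (hg : PTime g) : PTime (fun a => f a + g a) := by
  refine PTime.comp (f := fun p : ℤ × ℤ => p.1 + p.2) ?_ (hf.pair hg)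
  exact .of_prim .add .X (fun p => rfl) (fun p => by
    rw [Polynomial.eval_X, sz_pair]; exact sz_add_le _ _)

theorem PTime.sub {f g : γ → ℤ} (hf : PTime f) (hg : PTime g) : PTime (fun a => f a - g a) := by
  refine PTime.comp (f := fun p : ℤ × ℤ => p.1 - p.2) ?_ (hf.pair hg)
  refine .of_prim .sub .X (fun p => rfl) (fun p => ?_)
  have := sz_add_le p.1 (-p.2)
  rw [Polynomial.eval_X, sz_pair, sub_eq_add_neg]
  simpa [sz_int] using this

theorem PTime.cons {f : γ → α} {g : γ → List α} (hf : PTime f) (hg : PTime g) :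
    PTime (fun a => f a :: g a) := by
  obtain ⟨A, p, h⟩ := hf.pair hg
  -- A nonempty list is encoded as the pair of its head and tail, so the pairing program serves
  -- unchanged.
  exact ⟨A, p, h⟩

/-! ### Folds as while loops -/

/-- The test of the loop that computes a fold: is the list not exhausted? -/
def foldTest : Program := .seq (.prim .snd) (.seq (.prim .snd) (.prim .isPair))

/-- The body of the loop that computes a fold. -/
def foldBody (G : Program) : Program :=
  .fork (.prim .fst) (.fork
    (.seq (.fork (.prim .fst) (.seq (.prim .snd) (.fork (.prim .fst)
      (.seq (.prim .snd) (.prim .fst))))) G)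
    (.seq (.prim .snd) (.seq (.prim .snd) (.prim .snd))))

theorem runs_foldTest_nil (e acc : Data) :
    ∃ t ≤ 30 * (Data.pair e (.pair acc (.int 0))).size,
      Runs foldTest (.pair e (.pair acc (.int 0))) (.int 0) t := by
  refine ⟨_, ?_, .seq (.prim _ _) (.seq (.prim _ _) (.prim _ _))⟩
  simp [Prim.eval, Data.size]
  omega

theorem runs_foldTest_cons (e acc a l : Data) :
    ∃ t ≤ 30 * (Data.pair e (.pair acc (.pair a l))).size,
      Runs foldTest (.pair e (.pair acc (.pair a l))) (.int 1) t := by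
  refine ⟨_, ?_, .seq (.prim _ _) (.seq (.prim _ _) (.prim _ _))⟩
  simp [Prim.eval, Data.size]
  omega

theorem runs_foldBody {G : Program} {e acc a l acc' : Data} {s : ℕ}
    (h : Runs G (.pair e (.pair acc a)) acc' s) :
    ∃ t ≤ s + 60 * (Data.pair e (.pair acc (.pair a l))).size,
      Runs (foldBody G) (.pair e (.pair acc (.pair a l))) (.pair e (.pair acc' l)) t := by
  refine ⟨_, ?_, .fork (.prim _ _) (.fork (.seq (.fork (.prim _ _) (.seq (.prim _ _)
    (.fork (.prim _ _) (.seq (.prim _ _) (.prim _ _))))) h)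
      (.seq (.prim _ _) (.seq (.prim _ _) (.prim _ _))))⟩
  simp [Prim.eval, Data.size]
  omega

/-- The accumulators that occur are the folds over prefixes, and `M` dominates every loop state. One
round costs at most `30 * M` for the test, `60 * M` plus the call of `G` for the body, and `1 + M`
for the loop itself. -/
theorem runs_foldLoop {g : E → β → α → β} {G : Program} {p : Polynomial ℕ}
    (hG : ∀ x : E × (β × α), ∃ t, Runs G (enc x) (enc (g x.1 x.2.1 x.2.2)) t ∧ t ≤ p.eval (sz x))
    (e : E) (B M : ℕ) (l : List α) (acc : β)
    (hB : ∀ l' : List α, l' <+: l → sz (l'.foldl (g e) acc) ≤ B)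
    (hM : sz e + B + sz l + 10 ≤ M) :
    ∃ t ≤ (l.length + 1) * (p.eval M + 100 * M),
      Runs (.loop foldTest (foldBody G)) (enc (e, (acc, l)))
        (enc (e, (l.foldl (g e) acc, ([] : List α)))) t := by
  induction l generalizing acc with
  | nil =>
    obtain ⟨t, ht, hr⟩ := runs_foldTest_nil (enc e) (enc acc)
    refine ⟨_, ?_, Runs.loop_stop hr⟩
    have h1 := hB [] List.prefix_rfl
    have h2 : sz (e, (acc, ([] : List α))) ≤ M := by
      simp only [sz_pair, List.foldl_nil] at h1 ⊢
      omega
    change t + 1 + sz (e, (acc, ([] : List α))) ≤ _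
    change t ≤ 30 * sz (e, (acc, ([] : List α))) at ht
    simp only [List.length_nil, zero_add, one_mul]
    omega
  | cons a l ih =>
    have h1 : sz acc ≤ B := hB [] (List.nil_prefix)
    have h2 : sz (e, (acc, a :: l)) ≤ M := by
      simp only [sz_pair]
      omega
    have h3 : sz (e, (acc, a)) ≤ M := by
      simp only [sz_pair, sz_cons] at h2 ⊢
      omega
    obtain ⟨u, hu, hup⟩ := hG (e, (acc, a))
    obtain ⟨s, hs, hsr⟩ := runs_foldTest_cons (enc e) (enc acc) (enc a) (enc l)
    obtain ⟨v, hv, hvr⟩ := runs_foldBody (l := enc l) hu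
    obtain ⟨w, hw, hwr⟩ := ih (g e acc a)
      (fun l' hl' => hB (a :: l') (by simpa using hl')) (by rw [sz_cons] at hM; omega)
    refine ⟨_, ?_, .loop_step hsr (by simp) hvr hwr⟩
    change s ≤ 30 * sz (e, (acc, a :: l)) at hs
    change v ≤ u + 60 * sz (e, (acc, a :: l)) at hv
    change s + v + w + 1 + sz (e, (acc, a :: l)) ≤ _
    have h4 := polynomial_eval_mono p h3
    rw [List.length_cons, Nat.succ_mul]
    omega

/-- Iterating a polynomial-time step may blow up the accumulator exponentially, so its size has to
be bounded along all prefixes. -/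
theorem PTime.foldl {g : E → β → α → β} {b : E → β} {l : E → List α}
    (hg : PTime fun x : E × (β × α) => g x.1 x.2.1 x.2.2) (hb : PTime b) (hl : PTime l)
    (hq : ∃ q : Polynomial ℕ, ∀ e l', l' <+: l e → sz (l'.foldl (g e) (b e)) ≤ q.eval (sz e)) :
    PTime fun e => (l e).foldl (g e) (b e) := by
  obtain ⟨r, hr⟩ := hl.size_le
  obtain ⟨A, p, hA⟩ := PTime.pair (PTime.id (α := E)) (hb.pair hl)
  obtain ⟨G, pg, hG⟩ := hg
  obtain ⟨q, hq⟩ := hq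
  let M : Polynomial ℕ := .X + q + r + 10
  have hMe : ∀ n, M.eval n = n + q.eval n + r.eval n + 10 := by
    intro n; simp [M]
  refine ⟨.seq A (.seq (.loop foldTest (foldBody G)) (.seq (.prim .snd) (.prim .fst))),
    p + (M + 1) * (pg.comp M + 100 * M) + 10 * M + 20, fun e => ?_⟩
  obtain ⟨s, hs, hsp⟩ := hA e
  obtain ⟨t, ht, htr⟩ := runs_foldLoop (l := l e) (acc := b e) hG e (q.eval (sz e)) (M.eval (sz e))
    (hq e) (by have := hr e; rw [hMe]; omega)
  refine ⟨_, .seq hs (.seq htr (.seq (.prim _ _) (.prim _ _))), ?_⟩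
  have h1 := hq e _ (List.prefix_refl _)
  have h2 : (l e).length ≤ M.eval (sz e) := by
    have := hr e
    have := length_le_sz (l e)
    rw [hMe]; omega
  have h3 : sz ((l e).foldl (g e) (b e)) ≤ M.eval (sz e) := by rw [hMe]; omega
  have h4 : sz e ≤ M.eval (sz e) := by rw [hMe]; omega
  have h5 := Nat.mul_le_mul_right ((pg.eval (M.eval (sz e))) + 100 * M.eval (sz e))
    (Nat.add_le_add_right h2 1)
  have h6 : (Polynomial.eval (sz e) (10 : Polynomial ℕ)) = 10 := by simp
  have h7 : (Polynomial.eval (sz e) (20 : Polynomial ℕ)) = 20 := by simp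
  have h8 : (Polynomial.eval (sz e) (100 : Polynomial ℕ)) = 100 := by simp
  simp only [Polynomial.eval_add, Polynomial.eval_mul, Polynomial.eval_comp, Polynomial.eval_one,
    h6, h7, h8]
  simp only [enc, Prim.eval, Data.size, encodeList]
  unfold sz at *
  simp only [enc] at *
  simp
  omega

theorem PTime.foldl_of_sz_le {g : E → β → α → β} {b : E → β} {l : E → List α} (B : ℕ)
    (hg : PTime fun x : E × (β × α) => g x.1 x.2.1 x.2.2) (hb : PTime b) (hl : PTime l)
    (hB : ∀ b : β, sz b ≤ B) : PTime fun e => (l e).foldl (g e) (b e) :=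
  hg.foldl hb hl ⟨.C B, fun e l' _ => by simpa using hB _⟩

/-! ### List operations as folds -/

theorem PTime.any {f : E → α → Bool} {l : E → List α}
    (hl : PTime l) (hf : PTime fun x : E × α => f x.1 x.2) : PTime fun e => (l e).any (f e) := by
  have : PTime fun e => (l e).foldl (fun acc a => acc || f e a) false :=
    .foldl_of_sz_le (g := fun e acc a => acc || f e a) 2
      (PTime.or (.fst (.snd .id)) (hf.comp (.pair (.fst .id) (.snd (.snd .id))))) (.const _) hl sz_bool
  refine this.of_eq fun e => ?_
  have h : ∀ (l : List α) (b : Bool), l.foldl (fun acc a => acc || f e a) b = (b || l.any (f e)) := by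
    intro l
    induction l with
    | nil => simp
    | cons a l ih => intro b; simp [ih, Bool.or_assoc]
  simp [h]

theorem PTime.all {f : E → α → Bool} {l : E → List α}
    (hl : PTime l) (hf : PTime fun x : E × α => f x.1 x.2) : PTime fun e => (l e).all (f e) :=
  (hl.any (f := fun e a => !f e a) hf.not).not.of_eq fun e => by
    rw [List.any_eq_not_all_not]; simp

theorem sz_le_of_length_le {l : List α} {m : List β} {B : ℕ} (h : l.length ≤ m.length)
    (hB : ∀ a ∈ l, sz a ≤ B) : sz l ≤ 1 + sz m * (1 + B) :=
  (sz_le_of_forall hB).trans (Nat.add_le_add_left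
    (Nat.mul_le_mul_right _ (h.trans (length_le_sz m))) 1)

theorem PTime.reverse {l : E → List α} (hl : PTime l) : PTime fun e => (l e).reverse := by
  have h : ∀ (l acc : List α), l.foldl (fun acc a => a :: acc) acc = l.reverse ++ acc := by
    intro l
    induction l with
    | nil => simp
    | cons a l ih => intro b; simp [ih]
  obtain ⟨r, hr⟩ := hl.size_le
  have : PTime fun e => (l e).foldl (fun acc a => a :: acc) [] := by
    refine PTime.foldl (g := fun e acc a => a :: acc)
      (PTime.cons (.snd (.snd .id)) (.fst (.snd .id))) (.const _) hl
      ⟨1 + r * (1 + r), fun e l' hl' => ?_⟩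
    have h1 : sz l'.reverse ≤ 1 + sz (l e) * (1 + sz (l e)) := by
      refine sz_le_of_length_le (by simpa using hl'.length_le) fun a ha => sz_le_of_mem ?_
      exact hl'.subset (by simpa using ha)
    have h2 := hr e
    rw [h, List.append_nil]
    simp only [Polynomial.eval_add, Polynomial.eval_mul, Polynomial.eval_one]
    exact h1.trans (by gcongr)
  exact this.of_eq fun e => by simp [h]

theorem PTime.map {f : E → α → γ} {l : E → List α}
    (hl : PTime l) (hf : PTime fun x : E × α => f x.1 x.2) : PTime fun e => (l e).map (f e) := by
  have h : ∀ e (l : List α) (acc : List γ),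
      l.foldl (fun acc a => f e a :: acc) acc = (l.map (f e)).reverse ++ acc := by
    intro e l
    induction l with
    | nil => simp
    | cons a l ih => intro b; simp [ih]
  obtain ⟨r, hr⟩ := hl.size_le
  obtain ⟨p, hp⟩ := hf.size_le
  have : PTime fun e => (l e).foldl (fun acc a => f e a :: acc) [] := by
    refine PTime.foldl (g := fun e acc a => f e a :: acc)
      (PTime.cons (hf.comp (.pair (.fst .id) (.snd (.snd .id)))) (.fst (.snd .id))) (.const _) hl
      ⟨1 + r * (1 + p.comp (1 + .X + r)), fun e l' hl' => ?_⟩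
    have h2 := hr e
    rw [h, List.append_nil]
    simp only [Polynomial.eval_add, Polynomial.eval_mul, Polynomial.eval_one, Polynomial.eval_comp,
      Polynomial.eval_X]
    refine (sz_le_of_length_le (m := l e) (by simpa using hl'.length_le)
      (B := p.eval (1 + sz e + r.eval (sz e))) fun a ha => ?_).trans (by gcongr)
    simp only [List.mem_reverse, List.mem_map] at ha
    obtain ⟨a, ha, rfl⟩ := ha
    refine (hp (e, a)).trans (polynomial_eval_mono p ?_)
    have := sz_le_of_mem (hl'.subset ha)
    rw [sz_pair]
    dsimp only
    omega
  exact this.reverse.of_eq fun e => by simp [h]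

theorem PTime.filter {f : E → α → Bool} {l : E → List α}
    (hl : PTime l) (hf : PTime fun x : E × α => f x.1 x.2) : PTime fun e => (l e).filter (f e) := by
  have h : ∀ e (l : List α) (acc : List α),
      l.foldl (fun acc a => bif f e a then a :: acc else acc) acc =
        (l.filter (f e)).reverse ++ acc := by
    intro e l
    induction l with
    | nil => simp
    | cons a l ih => intro b; cases h : f e a <;> simp [ih, h]
  obtain ⟨r, hr⟩ := hl.size_le
  have : PTime fun e => (l e).foldl (fun acc a => bif f e a then a :: acc else acc) [] := by
    refine PTime.foldl (g := fun e acc a => bif f e a then a :: acc else acc)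
      (PTime.cond (hf.comp (.pair (.fst .id) (.snd (.snd .id))))
        (PTime.cons (.snd (.snd .id)) (.fst (.snd .id))) (.fst (.snd .id))) (.const _) hl
      ⟨1 + r * (1 + r), fun e l' hl' => ?_⟩
    have h2 := hr e
    rw [h, List.append_nil]
    simp only [Polynomial.eval_add, Polynomial.eval_mul, Polynomial.eval_one]
    refine (sz_le_of_length_le (m := l e) (B := sz (l e)) ?_ fun a ha => sz_le_of_mem ?_).trans
      (by gcongr)
    · rw [List.length_reverse]
      exact (List.length_filter_le _ _).trans hl'.length_le
    · simp only [List.mem_reverse, List.mem_filter] at ha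
      exact hl'.subset ha.1
  exact this.reverse.of_eq fun e => by simp [h]

theorem sz_append (l m : List α) : sz (l ++ m) + 1 = sz l + sz m := by
  induction l with
  | nil => simp [sz_nil]; omega
  | cons a l ih => simp only [List.cons_append, sz_cons]; omega

theorem PTime.append {l m : E → List α} (hl : PTime l) (hm : PTime m) :
    PTime fun e => l e ++ m e := by
  have h : ∀ (l acc : List α), l.foldl (fun acc a => a :: acc) acc = l.reverse ++ acc := by
    intro l
    induction l with
    | nil => simp
    | cons a l ih => intro b; simp [ih]
  obtain ⟨r, hr⟩ := hl.reverse.size_le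
  obtain ⟨q, hq⟩ := hm.size_le
  have : PTime fun e => (l e).reverse.foldl (fun acc a => a :: acc) (m e) := by
    refine PTime.foldl (g := fun e acc a => a :: acc)
      (PTime.cons (.snd (.snd .id)) (.fst (.snd .id))) hm hl.reverse
      ⟨1 + r * (1 + r) + q, fun e l' hl' => ?_⟩
    have h1 : sz l'.reverse ≤ 1 + sz (l e).reverse * (1 + sz (l e).reverse) := by
      refine sz_le_of_length_le (by simpa using hl'.length_le) fun a ha => sz_le_of_mem ?_
      exact hl'.subset (by simpa using ha)
    have h2 := hr e
    have h3 := hq e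
    have h4 := sz_append l'.reverse (m e)
    have h5 : 1 + sz (l e).reverse * (1 + sz (l e).reverse) ≤
      1 + r.eval (sz e) * (1 + r.eval (sz e)) := by gcongr
    rw [h]
    simp only [Polynomial.eval_add, Polynomial.eval_mul, Polynomial.eval_one]
    omega
  exact this.of_eq fun e => by simp [h]

theorem PTime.flatMap {f : E → α → List γ} {l : E → List α}
    (hl : PTime l) (hf : PTime fun x : E × α => f x.1 x.2) :
    PTime fun e => (l e).flatMap (f e) := by
  have h : ∀ e (l : List α) (acc : List γ),
      l.foldl (fun acc a => acc ++ f e a) acc = acc ++ l.flatMap (f e) := by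
    intro e l
    induction l with
    | nil => simp
    | cons a l ih => intro b; simp [ih]
  obtain ⟨r, hr⟩ := hl.size_le
  obtain ⟨p, hp⟩ := hf.size_le
  have : PTime fun e => (l e).foldl (fun acc a => acc ++ f e a) [] := by
    refine PTime.foldl (g := fun e acc a => acc ++ f e a)
      (PTime.append (.fst (.snd .id)) (hf.comp (.pair (.fst .id) (.snd (.snd .id))))) (.const _) hl
      ⟨1 + r * p.comp (1 + .X + r), fun e l' hl' => ?_⟩
    have h1 : ∀ (l' : List α), l' ⊆ l e →
        sz (l'.flatMap (f e)) ≤ 1 + l'.length * p.eval (1 + sz e + r.eval (sz e)) := by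
      intro l'
      induction l' with
      | nil => simp [sz_nil]
      | cons a l' ih =>
        intro hsub
        have h2 := ih fun x hx => hsub (List.mem_cons_of_mem _ hx)
        have h3 := sz_append (f e a) (l'.flatMap (f e))
        have h4 : sz (f e a) ≤ p.eval (1 + sz e + r.eval (sz e)) := by
          refine (hp (e, a)).trans (polynomial_eval_mono p ?_)
          have h5 : sz a ≤ sz (l e) := sz_le_of_mem (hsub (by simp))
          have h6 := hr e
          rw [sz_pair]
          dsimp only
          omega
        rw [List.flatMap_cons, List.length_cons, Nat.succ_mul]
        omega
    rw [h, List.nil_append]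
    simp only [Polynomial.eval_add, Polynomial.eval_mul, Polynomial.eval_one, Polynomial.eval_comp,
      Polynomial.eval_X]
    refine (h1 l' hl'.subset).trans ?_
    have h2 : l'.length ≤ r.eval (sz e) := hl'.length_le.trans ((length_le_sz _).trans (hr e))
    gcongr
  exact this.of_eq fun e => by simp [h]

end

end Manhattan

namespace Manhattan

/-! ### Layouts: coloured points with a hierarchy of column blocks -/

/-- Coloured points in the plane, no two in the same row, together with a laminar hierarchy of
blocks of consecutive columns: `blk s` numbers the blocks of height `s`. Blocks of height `0` are
columns, and a block of height `s + 1` consists of at most two blocks of height `s`. -/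
structure Layout (ι κ : Type) where
  X : ι → ℤ
  Y : ι → ℤ
  c : ι → κ
  blk : ℕ → ι → ℤ
  Y_inj : Function.Injective Y
  mono : ∀ s i j, X i ≤ X j → blk s i ≤ blk s j
  nest : ∀ s i j, blk s i = blk s j → blk (s + 1) i = blk (s + 1) j
  binary : ∀ s i j, blk (s + 1) i = blk (s + 1) j → blk s j ≤ blk s i + 1
  zero : ∀ i j, blk 0 i = blk 0 j → X i = X j

namespace Layout

variable {ι κ : Type} (L : Layout ι κ)

/-- Reflection in a vertical line. -/
def flipX : Layout ι κ where
  X i := -L.X i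
  Y := L.Y
  c := L.c
  blk s i := -L.blk s i
  Y_inj := L.Y_inj
  mono s i j h := neg_le_neg (L.mono s j i (neg_le_neg_iff.1 h))
  nest s i j h := neg_inj.2 (L.nest s i j (neg_inj.1 h))
  binary s i j h := by
    have := L.binary s j i (neg_inj.1 h).symm
    omega
  zero i j h := neg_inj.2 (L.zero i j (neg_inj.1 h))

/-- Reflection in a horizontal line. -/
def flipY : Layout ι κ where
  X := L.X
  Y i := -L.Y i
  c := L.c
  blk := L.blk
  Y_inj _ _ h := L.Y_inj (neg_inj.1 h)
  mono := L.mono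
  nest := L.nest
  binary := L.binary
  zero := L.zero

theorem blk_mono {s t : ℕ} (hst : s ≤ t) {i j : ι} (h : L.blk s i = L.blk s j) :
    L.blk t i = L.blk t j := by
  induction hst with
  | refl => exact h
  | step _ ih => exact L.nest _ _ _ ih

theorem lt_of_blk_lt {s : ℕ} {i j : ι} (h : L.blk s i < L.blk s j) : L.X i < L.X j :=
  lt_of_not_ge fun h' => absurd (L.mono s j i h') (by omega)

/-- A pair of points of different colours in the block of height `hi` of `z`, of which exactly one
lies in the block of height `lo` of `z`. -/
def Cross (lo hi : ℕ) (z s t : ι) : Prop :=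
  L.blk hi s = L.blk hi z ∧ L.blk hi t = L.blk hi z ∧
    ¬(L.blk lo s = L.blk lo z ↔ L.blk lo t = L.blk lo z) ∧ L.c s ≠ L.c t

/-- `(s, t)` is a crossing pair such that no other crossing pair between these rows ends below `t`,
and `z` is the last point below `t` in its block of height `lo`. -/
def UpKeyAt (lo hi : ℕ) (z s t : ι) : Prop :=
  L.Y s < L.Y t ∧ L.Cross lo hi z s t ∧ L.Y z < L.Y t ∧
    (∀ z', L.blk lo z' = L.blk lo z → L.Y z' < L.Y t → L.Y z' ≤ L.Y z) ∧
    ∀ s' t', L.Y s ≤ L.Y s' → L.Y s' < L.Y t' → L.Y t' < L.Y t → ¬L.Cross lo hi z s' t'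

def UpKey (lo hi : ℕ) (z : ι) : Prop := ∃ s t, L.UpKeyAt lo hi z s t

/-- The last column of the block of height `m` of `z`. -/
def IsMax (m : ℕ) (z : ι) (x : ℤ) : Prop :=
  ∃ i, L.X i = x ∧ L.blk m i = L.blk m z ∧ ∀ j, L.blk m j = L.blk m z → L.X j ≤ x

/-- The first column of the block of height `m` of `z`. -/
def IsMin (m : ℕ) (z : ι) (x : ℤ) : Prop :=
  ∃ i, L.X i = x ∧ L.blk m i = L.blk m z ∧ ∀ j, L.blk m j = L.blk m z → x ≤ L.X j

/-- The first column after the block of height `m` of `z`. -/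
def IsNext (m : ℕ) (z : ι) (x : ℤ) : Prop :=
  ∃ i, L.X i = x ∧ L.blk m z < L.blk m i ∧ ∀ j, L.blk m z < L.blk m j → x ≤ L.X j

/-- The last column before the block of height `m` of `z`. -/
def IsPrev (m : ℕ) (z : ι) (x : ℤ) : Prop :=
  ∃ i, L.X i = x ∧ L.blk m i < L.blk m z ∧ ∀ j, L.blk m j < L.blk m z → L.X j ≤ x

/-- The four columns at the boundary of the block of height `m` of `z`. -/
def Bd (m : ℕ) (z : ι) (x : ℤ) : Prop :=
  L.IsMax m z x ∨ L.IsMin m z x ∨ L.IsNext m z x ∨ L.IsPrev m z x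

/-- `T` contains the projections of all keys to the boundary columns of their blocks. -/
def Covers (H : ℕ) (T : Set (ℤ × ℤ)) : Prop :=
  ∀ k i, (i + 1) * 2 ^ k ≤ H → ∀ z, L.UpKey (i * 2 ^ k) ((i + 1) * 2 ^ k) z →
    ∀ m, (m = i * 2 ^ k ∨ m = i * 2 ^ k + 2 ^ k / 2) → ∀ x, L.Bd m z x → (x, L.Y z) ∈ T

variable {L}

/-! ### Behaviour of keys and boundary columns under reflection -/

theorem isMax_flipX {m : ℕ} {z : ι} {x : ℤ} : L.flipX.IsMax m z x ↔ L.IsMin m z (-x) := by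
  refine exists_congr fun i => and_congr ?_ (and_congr neg_inj (forall_congr' fun j =>
    imp_congr neg_inj ?_))
  · change -L.X i = x ↔ L.X i = -x
    omega
  · change -L.X j ≤ x ↔ -x ≤ L.X j
    omega

theorem isMin_flipX {m : ℕ} {z : ι} {x : ℤ} : L.flipX.IsMin m z x ↔ L.IsMax m z (-x) := by
  refine exists_congr fun i => and_congr ?_ (and_congr neg_inj (forall_congr' fun j =>
    imp_congr neg_inj ?_))
  · change -L.X i = x ↔ L.X i = -x
    omega
  · change x ≤ -L.X j ↔ L.X j ≤ -x
    omega

theorem isNext_flipX {m : ℕ} {z : ι} {x : ℤ} : L.flipX.IsNext m z x ↔ L.IsPrev m z (-x) := by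
  refine exists_congr fun i => and_congr ?_ (and_congr neg_lt_neg_iff (forall_congr' fun j =>
    imp_congr neg_lt_neg_iff ?_))
  · change -L.X i = x ↔ L.X i = -x
    omega
  · change x ≤ -L.X j ↔ L.X j ≤ -x
    omega

theorem isPrev_flipX {m : ℕ} {z : ι} {x : ℤ} : L.flipX.IsPrev m z x ↔ L.IsNext m z (-x) := by
  refine exists_congr fun i => and_congr ?_ (and_congr neg_lt_neg_iff (forall_congr' fun j =>
    imp_congr neg_lt_neg_iff ?_))
  · change -L.X i = x ↔ L.X i = -x
    omega
  · change -L.X j ≤ x ↔ -x ≤ L.X j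
    omega

theorem bd_flipX {m : ℕ} {z : ι} {x : ℤ} : L.flipX.Bd m z x ↔ L.Bd m z (-x) := by
  simp only [Bd, isMax_flipX, isMin_flipX, isNext_flipX, isPrev_flipX]
  tauto

theorem cross_flipX {lo hi : ℕ} {z s t : ι} :
    L.flipX.Cross lo hi z s t ↔ L.Cross lo hi z s t := by
  simp [Cross, flipX]

theorem upKeyAt_flipX {lo hi : ℕ} {z s t : ι} :
    L.flipX.UpKeyAt lo hi z s t ↔ L.UpKeyAt lo hi z s t := by
  simp only [UpKeyAt, cross_flipX]
  simp [flipX]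

theorem upKey_flipX {lo hi : ℕ} {z : ι} : L.flipX.UpKey lo hi z ↔ L.UpKey lo hi z := by
  simp only [UpKey, upKeyAt_flipX]

/-- Keys do not see left and right, and the reflection permutes the four boundary columns. Thus only
the reflection of the rows needs points of its own. -/
theorem Covers.flipX {H : ℕ} {T : Set (ℤ × ℤ)} (h : L.Covers H T) :
    L.flipX.Covers H {p | (-p.1, p.2) ∈ T} :=
  fun k i hi z hz m hm x hx => h k i hi z (upKey_flipX.1 hz) m hm (-x) (bd_flipX.1 hx)

theorem cross_congr {lo hi : ℕ} {z z' s t : ι} (hlo : L.blk lo z = L.blk lo z')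
    (hhi : L.blk hi z = L.blk hi z') : L.Cross lo hi z s t ↔ L.Cross lo hi z' s t := by
  simp only [Cross, hlo, hhi]

theorem exists_isMax [Finite ι] (m : ℕ) (z : ι) : ∃ x, L.IsMax m z x := by
  obtain ⟨i, hi, h⟩ := Set.exists_max_image {i | L.blk m i = L.blk m z} L.X (Set.toFinite _) ⟨z, rfl⟩
  exact ⟨L.X i, i, rfl, hi, h⟩

theorem IsMax.congr {m : ℕ} {z z' : ι} {x : ℤ} (h : L.IsMax m z x)
    (hz : L.blk m z = L.blk m z') : L.IsMax m z' x := by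
  simpa only [IsMax, hz] using h

theorem IsMax.le {s t : ℕ} (hst : s ≤ t) {z z' : ι} {x y : ℤ} (h : L.IsMax s z x)
    (h' : L.IsMax t z' y) (hz : L.blk s z = L.blk s z') : x ≤ y := by
  obtain ⟨i, rfl, hi, -⟩ := h
  obtain ⟨j, rfl, hj, hm⟩ := h'
  exact hm i (L.blk_mono hst (hi.trans hz))

/-! ### Monotone paths through the keys -/

/-- The state of a path that starts in the block of `p` and is on its way to `q`: it has reached the
row of `e`, and up to that row the block of height `hi` contains only points of the block of height
`lo` of `p`. -/
structure State (L : Layout ι κ) (lo hi : ℕ) (p e q : ι) : Prop where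
  same : L.blk hi p = L.blk hi q
  conf : L.c p ≠ L.c q
  lt : L.Y p < L.Y q
  blk_eq : L.blk lo e = L.blk lo p
  le : L.Y p ≤ L.Y e
  run : ∀ r, L.blk hi r = L.blk hi p → L.Y p ≤ L.Y r → L.Y r ≤ L.Y e → L.blk lo r = L.blk lo p

/-- Since `(p, q)` crosses, there is a crossing pair from row `p` on with the earliest end `t`; its
key is the last point `z` of the block below `t`. If the run extends to `z`, the state keeps `p`.
Otherwise the path restarts at `z`, which has the colour of `p`. -/
theorem State.exists_upKey [Finite ι] {lo hi : ℕ} (hlh : lo ≤ hi) {p e q : ι}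
    (S : L.State lo hi p e q) (hlo : L.blk lo p ≠ L.blk lo q) :
    ∃ z p', L.UpKey lo hi z ∧ L.blk lo p' = L.blk lo p ∧ L.Y e ≤ L.Y z ∧ L.Y z < L.Y q ∧
      L.State lo hi p' z q := by
  obtain ⟨⟨s, t⟩, ⟨hps, hst, htq, hcr⟩, hmin⟩ := Set.exists_min_image
    {x : ι × ι | L.Y p ≤ L.Y x.1 ∧ L.Y x.1 < L.Y x.2 ∧ L.Y x.2 ≤ L.Y q ∧ L.Cross lo hi p x.1 x.2}
    (fun x => L.Y x.2) (Set.toFinite _)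
    ⟨(p, q), le_rfl, S.lt, le_rfl, rfl, S.same.symm, by simpa using hlo.symm, S.conf⟩
  simp only [Set.mem_ofPred_eq, Prod.forall, and_imp] at hps hst htq hcr hmin
  obtain ⟨z, ⟨hz, hzt⟩, hzmax⟩ := Set.exists_max_image
    {z | L.blk lo z = L.blk lo p ∧ L.Y z < L.Y t} L.Y (Set.toFinite _) ⟨p, rfl, by omega⟩
  simp only [Set.mem_ofPred_eq, and_imp] at hzmax
  have hzhi : L.blk hi z = L.blk hi p := L.blk_mono hlh hz
  -- If `t` were not above `e`, the run would put both ends of the pair into the small block.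
  have het : L.Y e < L.Y t := by
    by_contra! h
    refine hcr.2.2.1 (iff_of_true ?_ ?_)
    · exact S.run s hcr.1 hps (by omega)
    · exact S.run t hcr.2.1 (by omega) h
  have hpz : L.Y p ≤ L.Y z := hzmax p rfl (by omega)
  have hno : ∀ s' t', L.Y p ≤ L.Y s' → L.Y s' < L.Y t' → L.Y t' < L.Y t → ¬L.Cross lo hi p s' t' :=
    fun s' t' h1 h2 h3 h4 => by have := hmin s' t' h1 h2 (by omega) h4; omega
  have hkey : L.UpKey lo hi z := by
    refine ⟨s, t, hst, (cross_congr hz hzhi).2 hcr, hzt, fun z' h1 h2 => hzmax z' (h1.trans hz) h2,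
      fun s' t' h1 h2 h3 h4 => ?_⟩
    exact hno s' t' (by omega) h2 h3 ((cross_congr hz hzhi).1 h4)
  have hez := hzmax e S.blk_eq het
  by_cases hall : ∀ r, L.blk hi r = L.blk hi p → L.Y p ≤ L.Y r → L.Y r ≤ L.Y z →
      L.blk lo r = L.blk lo p
  · exact ⟨z, p, hkey, rfl, hez, by omega, S.same, S.conf, S.lt, hz, hpz, hall⟩
  · push Not at hall
    obtain ⟨b, hb, hpb, hbz, hbw⟩ := hall
    -- The point `b` outside the small block forms no crossing pair with `p` or `z`, so all three
    -- have the same colour.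
    have hpb' : L.Y p < L.Y b := lt_of_le_of_ne hpb fun h => hbw (by rw [L.Y_inj h])
    have hbz' : L.Y b < L.Y z := lt_of_le_of_ne hbz fun h => hbw (by rw [L.Y_inj h, hz])
    have h1 : L.c p = L.c b := by
      by_contra h
      exact hno p b le_rfl hpb' (by omega) ⟨rfl, hb, by simpa using hbw, h⟩
    have h2 : L.c b = L.c z := by
      by_contra h
      exact hno b z hpb hbz' hzt ⟨hb, hzhi, by simpa [hz] using hbw, h⟩
    refine ⟨z, z, hkey, hz, hez, by omega, hzhi.trans S.same, ?_, by omega, rfl, le_rfl, ?_⟩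
    · rw [← h2, ← h1]; exact S.conf
    · intro r _ h3 h4
      rw [L.Y_inj (le_antisymm h4 h3)]

/-- A step to the right or upwards between points of `T`. -/
def UpStep (T : Set (ℤ × ℤ)) (a b : ℤ × ℤ) : Prop :=
  a ∈ T ∧ b ∈ T ∧ (a.1 = b.1 ∨ a.2 = b.2) ∧ a.1 ≤ b.1 ∧ a.2 ≤ b.2

open Relation (ReflTransGen)

/-- The interval of level `k` containing `d` is halved until it is from `d` to `d + 1`; the path
always stands in the last column of the block at its lower height. -/
theorem State.exists_path [Finite ι] {H : ℕ} {T : Set (ℤ × ℤ)} (hT : L.Covers H T) {q : ι} (d k : ℕ)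
    (hk : (d / 2 ^ k + 1) * 2 ^ k ≤ H) {p e : ι} {x : ℤ}
    (S : L.State (d / 2 ^ k * 2 ^ k) ((d / 2 ^ k + 1) * 2 ^ k) p e q)
    (hsame : L.blk (d + 1) p = L.blk (d + 1) q) (hne : L.blk d p ≠ L.blk d q)
    (hx : L.IsMax (d / 2 ^ k * 2 ^ k) p x) (hxT : (x, L.Y e) ∈ T) :
    ∃ p' e' x', L.State d (d + 1) p' e' q ∧ L.blk d p' = L.blk d p ∧ L.IsMax d p' x' ∧
      (x', L.Y e') ∈ T ∧ ReflTransGen (UpStep T) (x, L.Y e) (x', L.Y e') := by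
  induction k generalizing p e x with
  | zero =>
    simp only [pow_zero, Nat.div_one, mul_one] at S hx
    exact ⟨p, e, x, S, rfl, hx, hxT, .refl⟩
  | succ k ih =>
    have hpos : 0 < 2 ^ k := by positivity
    set i := d / 2 ^ (k + 1) with hi
    set i' := d / 2 ^ k with hi'
    have hii : i = i' / 2 := by rw [hi, hi', Nat.div_div_eq_div_mul, pow_succ]
    have hd1 : i' * 2 ^ k ≤ d := Nat.div_mul_le_self _ _
    have hd2 : d < (i' + 1) * 2 ^ k := Nat.lt_mul_of_div_lt (Nat.lt_succ_self _) hpos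
    have hp : (2 : ℕ) ^ (k + 1) = 2 * 2 ^ k := by rw [pow_succ, mul_comm]
    rcases Nat.even_or_odd' i' with ⟨j, hj | hj⟩
    -- Here `d` is in the lower half: only the upper height drops, and the path does not move.
    · have hj' : i = j := by omega
      have e1 : i * 2 ^ (k + 1) = i' * 2 ^ k := by rw [hj', hj, hp]; ring
      have e2 : (i + 1) * 2 ^ (k + 1) = i' * 2 ^ k + 2 ^ k + 2 ^ k := by rw [hj', hj, hp]; ring
      have e3 : (i' + 1) * 2 ^ k = i' * 2 ^ k + 2 ^ k := by ring
      rw [e1] at S hx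
      rw [e2] at S hk
      rw [e3] at ih hd2
      refine ih (by omega) ⟨L.blk_mono (by omega) hsame, S.conf, S.lt, S.blk_eq, S.le,
        fun r hr => S.run r (L.blk_mono (by omega) hr)⟩ hsame hne hx hxT
    · have hj' : i = j := by omega
      have e1 : i * 2 ^ (k + 1) + 2 ^ k = i' * 2 ^ k := by rw [hj', hj, hp]; ring
      have e2 : (i + 1) * 2 ^ (k + 1) = (i' + 1) * 2 ^ k := by rw [hj', hj, hp]; ring
      have e3 : 2 ^ (k + 1) / 2 = 2 ^ k := by omega
      have hlo : i * 2 ^ (k + 1) ≤ d := by omega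
      obtain ⟨z, p', hz, hp', hez, hzq, S'⟩ := S.exists_upKey (by
        exact Nat.mul_le_mul_right _ (Nat.le_succ _)) fun h => hne (L.blk_mono hlo h)
      have hmid : L.blk (i' * 2 ^ k) p' = L.blk (i' * 2 ^ k) p := L.blk_mono (by omega) hp'
      have hdp : L.blk d p' = L.blk d p := L.blk_mono hd1 hmid
      have hzp : L.blk (i * 2 ^ (k + 1)) p = L.blk (i * 2 ^ (k + 1)) z := (S'.blk_eq.trans hp').symm
      obtain ⟨y, hy⟩ := exists_isMax (L := L) (i' * 2 ^ k) p'
      have hyz : L.IsMax (i' * 2 ^ k) z y :=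
        hy.congr (L.blk_mono (by omega) S'.blk_eq.symm)
      have hT1 : (x, L.Y z) ∈ T := hT _ _ hk z hz _ (.inl rfl) x (.inl (hx.congr hzp))
      have hT2 : (y, L.Y z) ∈ T := hT _ _ hk z hz _ (.inr rfl) y (.inl (by rw [e3, e1]; exact hyz))
      obtain ⟨p'', e'', x'', h1, h2, h3, h4, h5⟩ := ih (by rw [← e2]; exact hk)
        ⟨by rw [← e2]; exact S'.same, S'.conf, S'.lt, L.blk_mono (by omega) S'.blk_eq, S'.le,
          fun r hr h1 h2 => L.blk_mono (by omega) (S'.run r (by rw [e2]; exact hr) h1 h2)⟩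
        ((L.blk_mono (by omega) hdp).trans hsame) (by rw [hdp]; exact hne) hy hT2
      refine ⟨p'', e'', x'', h1, h2.trans hdp, h3, h4, .head (b := (x, L.Y z)) ?_ (.head (b := (y, L.Y z)) ?_ h5)⟩
      · exact ⟨hxT, hT1, .inl rfl, le_rfl, hez⟩
      · exact ⟨hT1, hT2, .inr rfl, hx.le (by omega) hyz hzp, le_rfl⟩

theorem isMax_zero (p : ι) : L.IsMax 0 p (L.X p) :=
  ⟨p, rfl, rfl, fun _ hj => (L.zero _ _ hj).le⟩

/-- At level `K` the interval starts at height `0`, where a block is a single column, and its top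
block contains everything. The initial run consists of the row of `p` alone. -/
theorem exists_path_of_start [Finite ι] {H K : ℕ} {T : Set (ℤ × ℤ)} (hT : L.Covers H T)
    (hK : 2 ^ K ≤ H) (htop : ∀ i j, L.blk (2 ^ K) i = L.blk (2 ^ K) j) {d : ℕ} {p q : ι}
    (hsame : L.blk (d + 1) p = L.blk (d + 1) q) (hne : L.blk d p ≠ L.blk d q)
    (hc : L.c p ≠ L.c q) (hY : L.Y p < L.Y q) (hp : (L.X p, L.Y p) ∈ T) :
    ∃ p' e' x', L.State d (d + 1) p' e' q ∧ L.blk d p' = L.blk d p ∧ L.IsMax d p' x' ∧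
      (x', L.Y e') ∈ T ∧ ReflTransGen (UpStep T) (L.X p, L.Y p) (x', L.Y e') := by
  have hd : d < 2 ^ K := by
    by_contra! h
    exact hne (L.blk_mono h (htop p q))
  have h0 : d / 2 ^ K = 0 := Nat.div_eq_of_lt hd
  refine State.exists_path hT d K (by rw [h0]; simpa using hK) ?_ hsame hne ?_ hp
  · rw [h0, zero_mul, zero_add, one_mul]
    refine ⟨htop _ _, hc, hY, rfl, le_rfl, fun r _ h1 h2 => ?_⟩
    rw [L.Y_inj (le_antisymm h1 h2)]
  · rw [h0, zero_mul]; exact isMax_zero p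

/-- A half turn reverses monotone paths, so a path built from `q` in the turned layout becomes one
that ends at `q`. -/
theorem upStep_swap_neg {T : Set (ℤ × ℤ)} {a b : ℤ × ℤ}
    (h : ReflTransGen (UpStep {p | (-p.1, -p.2) ∈ T}) a b) :
    ReflTransGen (UpStep T) (-b.1, -b.2) (-a.1, -a.2) := by
  induction h with
  | refl => exact .refl
  | tail _ hbc ih =>
    obtain ⟨h1, h2, h3, h4, h5⟩ := hbc
    refine .head ⟨h2, h1, ?_, neg_le_neg h4, neg_le_neg h5⟩ ih
    simp only [neg_inj]
    exact h3.imp Eq.symm Eq.symm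

theorem exists_upPath [Finite ι] {H K : ℕ} {T : Set (ℤ × ℤ)} (hT : L.Covers H T)
    (hT' : L.flipY.Covers H {p | (p.1, -p.2) ∈ T}) (hP : ∀ i, (L.X i, L.Y i) ∈ T)
    (hK : 2 ^ K ≤ H) (htop : ∀ i j, L.blk (2 ^ K) i = L.blk (2 ^ K) j) {p q : ι}
    (hX : L.X p < L.X q) (hY : L.Y p < L.Y q) (hc : L.c p ≠ L.c q) :
    ReflTransGen (UpStep T) (L.X p, L.Y p) (L.X q, L.Y q) := by
  classical
  have hex : ∃ s, L.blk s p = L.blk s q := ⟨_, htop p q⟩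
  obtain ⟨d, hd⟩ : ∃ d, Nat.find hex = d + 1 := Nat.exists_eq_succ_of_ne_zero fun h => by
    have h1 := Nat.find_spec hex
    rw [h] at h1
    exact hX.ne (L.zero _ _ h1)
  have hsame : L.blk (d + 1) p = L.blk (d + 1) q := hd ▸ Nat.find_spec hex
  have hne : L.blk d p ≠ L.blk d q := Nat.find_min hex (by omega)
  have hdH : d + 1 ≤ H := by
    have : d < 2 ^ K := by
      by_contra! h
      exact hne (L.blk_mono h (htop p q))
    omega
  obtain ⟨p₁, e, x, S, hp₁, hx, hxT, path⟩ :=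
    exists_path_of_start hT hK htop hsame hne hc hY (hP p)
  -- The row of this level `0` key is where the path passes from the block of `p` to that of `q`.
  obtain ⟨z, p₂, hz, hp₂, hez, hzq, S₂⟩ := S.exists_upKey (Nat.le_succ d) (by rwa [hp₁])
  have hp₂' : L.blk d p₂ = L.blk d p := hp₂.trans hp₁
  -- The path from `q` aims at `p₂` rather than `p`, so that its state can be compared with `S₂`.
  obtain ⟨q₁, f, y, R, hq₁, hy, hyT, path'⟩ :=
    exists_path_of_start (L := L.flipY.flipX) hT'.flipX hK
      (fun i j => neg_inj.2 (htop i j)) (d := d) (p := q) (q := p₂) (neg_inj.2 S₂.same.symm)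
      (fun h => hne (by rw [← hp₂']; exact (neg_inj.1 h).symm)) S₂.conf.symm (neg_lt_neg S₂.lt)
      (by simpa [flipX, flipY] using hP q)
  have hq₁' : L.blk d q₁ = L.blk d q := neg_inj.1 hq₁
  have hRs : L.blk (d + 1) q₁ = L.blk (d + 1) p₂ := neg_inj.1 R.same
  have hRlt : L.Y p₂ < L.Y q₁ := neg_lt_neg_iff.1 R.lt
  have hRrun : ∀ r, L.blk (d + 1) r = L.blk (d + 1) q₁ → L.Y r ≤ L.Y q₁ → L.Y f ≤ L.Y r →
      L.blk d r = L.blk d q₁ := fun r h1 h2 h3 =>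
    neg_inj.1 (R.run r (neg_inj.2 h1) (neg_le_neg h2) (neg_le_neg h3))
  have hy' : L.IsMin d q₁ (-y) := (isMax_flipX (L := L.flipY)).1 hy
  have hlt : L.blk d p < L.blk d q := lt_of_le_of_ne (L.mono _ _ _ hX.le) hne
  have hbin : L.blk d q ≤ L.blk d p + 1 := L.binary d p q hsame
  have hxz : L.IsMax d z x := hx.congr (S₂.blk_eq.trans hp₂).symm
  have hzb : L.blk d z = L.blk d p := S₂.blk_eq.trans hp₂'
  -- A block of height `d + 1` has at most two halves, so the block of `q` immediately follows that
  -- of `z`.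
  have hnext : L.IsNext d z (-y) := by
    obtain ⟨i, hi, hib, him⟩ := hy'
    refine ⟨i, hi, by omega, fun j hj => ?_⟩
    by_cases hjq : L.blk d j = L.blk d q
    · exact him j (by omega)
    · rw [← hi]
      exact (L.lt_of_blk_lt (s := d) (by omega)).le
  -- If the paths overlapped in height, either `z` would lie in the run of `q₁` or `q₁` in the run
  -- of `p₂`, hence in the wrong half.
  have hzf : L.Y z ≤ L.Y f := by
    by_contra! hfz
    rcases le_or_gt (L.Y z) (L.Y q₁) with h | h
    · have := hRrun z ((L.blk_mono (Nat.le_succ d) S₂.blk_eq).trans hRs.symm) h hfz.le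
      omega
    · have := S₂.run q₁ hRs hRlt.le h.le
      omega
  have hT1 : (x, L.Y z) ∈ T := by
    have := hT 0 d (by simpa using hdH) z (by simpa using hz) d (by simp) x (.inl hxz)
    exact this
  have hT2 : (-y, L.Y z) ∈ T :=
    hT 0 d (by simpa using hdH) z (by simpa using hz) d (by simp) (-y) (.inr (.inr (.inl hnext)))
  have hT3 : (-y, L.Y f) ∈ T := by simpa [flipX, flipY] using hyT
  have hxy : x ≤ -y := by
    obtain ⟨i, rfl, hi, -⟩ := hxz
    obtain ⟨j, hj, hjb, -⟩ := hnext
    rw [← hj]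
    exact (L.lt_of_blk_lt (s := d) (by omega)).le
  have path'' : ReflTransGen (UpStep T) (-y, L.Y f) (L.X q, L.Y q) := by
    have := upStep_swap_neg (T := T) path'
    simpa [flipX, flipY] using this
  refine path.trans (.head ⟨hxT, hT1, .inl rfl, le_rfl, hez⟩ (.head ⟨hT1, hT2, .inr rfl, hxy, le_rfl⟩
    (.head ⟨hT2, hT3, .inl rfl, le_rfl, hzf⟩ path'')))

end Layout

end Manhattan

namespace Manhattan

/-! ### Manhattan connections -/

theorem dist1_comm (p q : ℝ × ℝ) : dist1 p q = dist1 q p := by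
  simp only [dist1, abs_sub_comm]

theorem dist1_triangle (p q r : ℝ × ℝ) : dist1 p r ≤ dist1 p q + dist1 q r := by
  have h1 := abs_sub_le p.1 q.1 r.1
  have h2 := abs_sub_le p.2 q.2 r.2
  unfold dist1
  linarith

theorem MConnected.refl {X : Set (ℝ × ℝ)} {p : ℝ × ℝ} (hp : p ∈ X) : MConnected X p p :=
  ⟨0, fun _ => p, rfl, rfl, fun _ _ => hp, by simp, by simp [dist1]⟩

theorem MConnected.cons {X : Set (ℝ × ℝ)} {p r q : ℝ × ℝ} (hp : p ∈ X) (hpr : Aligned p r)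
    (hd : dist1 p r + dist1 r q = dist1 p q) (h : MConnected X r q) : MConnected X p q := by
  obtain ⟨m, v, h0, hm, hX, ha, hs⟩ := h
  refine ⟨m + 1, fun i => Nat.casesOn i p v, rfl, hm, fun i hi => ?_, fun i hi => ?_, ?_⟩
  · cases i with
    | zero => exact hp
    | succ i => exact hX i (by omega)
  · cases i with
    | zero => change Aligned p (v 0); rwa [h0]
    | succ i => exact ha i (by omega)
  · rw [Finset.sum_range_succ']
    change ∑ i ∈ Finset.range m, dist1 (v i) (v (i + 1)) + dist1 p (v 0) = _
    rw [hs, h0, ← hd, add_comm]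

theorem MConnected.symm {X : Set (ℝ × ℝ)} {p q : ℝ × ℝ} (h : MConnected X p q) :
    MConnected X q p := by
  obtain ⟨m, v, h0, hm, hX, ha, hs⟩ := h
  refine ⟨m, fun i => v (m - i), by simpa, by simpa, fun i _ => hX _ (by omega), fun i hi => ?_, ?_⟩
  · have := ha (m - (i + 1)) (by omega)
    rw [show m - (i + 1) + 1 = m - i by omega] at this
    exact this.imp Eq.symm Eq.symm
  · rw [dist1_comm, ← hs, ← Finset.sum_range_reflect]
    refine Finset.sum_congr rfl fun i hi => ?_
    have hi := Finset.mem_range.1 hi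
    dsimp only
    rw [dist1_comm, show m - (m - 1 - i + 1) = i by omega, show m - (m - 1 - i) = i + 1 by omega]

theorem MConnected.map {X X' : Set (ℝ × ℝ)} {p q : ℝ × ℝ} (f : ℝ × ℝ → ℝ × ℝ)
    (hf : ∀ x ∈ X, f x ∈ X') (ha : ∀ x y, Aligned x y → Aligned (f x) (f y))
    (hd : ∀ x y, dist1 (f x) (f y) = dist1 x y) (h : MConnected X p q) :
    MConnected X' (f p) (f q) := by
  obtain ⟨m, v, h0, hm, hX, hv, hs⟩ := h
  refine ⟨m, fun i => f (v i), by simp [h0], by simp [hm], fun i hi => hf _ (hX i hi),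
    fun i hi => ha _ _ (hv i hi), ?_⟩
  simp only [hd, hs]

theorem dist1_negX (x y : ℝ × ℝ) : dist1 (-x.1, x.2) (-y.1, y.2) = dist1 x y := by
  have : -x.1 - -y.1 = -(x.1 - y.1) := by ring
  simp only [dist1, this, abs_neg]

theorem dist1_negY (x y : ℝ × ℝ) : dist1 (x.1, -x.2) (y.1, -y.2) = dist1 x y := by
  have : -x.2 - -y.2 = -(x.2 - y.2) := by ring
  simp only [dist1, this, abs_neg]

theorem MConnected.negX {X X' : Set (ℝ × ℝ)} {p q : ℝ × ℝ} (h : MConnected X p q)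
    (hX : ∀ x ∈ X, (-x.1, x.2) ∈ X') : MConnected X' (-p.1, p.2) (-q.1, q.2) :=
  h.map (fun x => (-x.1, x.2)) hX (fun _ _ => Or.imp_left fun h => neg_inj.2 h) dist1_negX

theorem MConnected.negY {X X' : Set (ℝ × ℝ)} {p q : ℝ × ℝ} (h : MConnected X p q)
    (hX : ∀ x ∈ X, (x.1, -x.2) ∈ X') : MConnected X' (p.1, -p.2) (q.1, -q.2) :=
  h.map (fun x => (x.1, -x.2)) hX (fun _ _ => Or.imp_right fun h => neg_inj.2 h) dist1_negY

theorem dist1_add_of_le {p q r : ℝ × ℝ} (h1 : p ≤ q) (h2 : q ≤ r) :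
    dist1 p q + dist1 q r = dist1 p r := by
  have a1 := h1.1; have a2 := h1.2; have b1 := h2.1; have b2 := h2.2
  unfold dist1
  rw [abs_of_nonpos, abs_of_nonpos, abs_of_nonpos, abs_of_nonpos, abs_of_nonpos, abs_of_nonpos]
  all_goals linarith

theorem dist1_le_sum (v : ℕ → ℝ × ℝ) (i j : ℕ) :
    dist1 (v i) (v (i + j)) ≤ ∑ t ∈ Finset.range j, dist1 (v (i + t)) (v (i + t + 1)) := by
  induction j with
  | zero => simp [dist1]
  | succ j ih =>
    rw [Finset.sum_range_succ]
    exact (dist1_triangle _ _ _).trans (add_le_add_left ih _)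

theorem between_of_abs_add_le {a b x : ℝ} (h : |a - x| + |x - b| ≤ |a - b|) :
    min a b ≤ x ∧ x ≤ max a b := by
  rcases le_total a b with hab | hab
  · rw [abs_of_nonpos (by linarith : a - b ≤ 0)] at h
    rw [min_eq_left hab, max_eq_right hab]
    have h1 := neg_abs_le (a - x); have h2 := neg_abs_le (x - b)
    have h3 := le_abs_self (a - x); have h4 := le_abs_self (x - b)
    constructor <;> linarith
  · rw [abs_of_nonneg (by linarith : 0 ≤ a - b)] at h
    rw [min_eq_right hab, max_eq_left hab]
    have h1 := neg_abs_le (a - x); have h2 := neg_abs_le (x - b)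
    have h3 := le_abs_self (a - x); have h4 := le_abs_self (x - b)
    constructor <;> linarith

theorem mem_box_of_dist1_le {p q x : ℝ × ℝ} (h : dist1 p x + dist1 x q ≤ dist1 p q) :
    (min p.1 q.1 ≤ x.1 ∧ x.1 ≤ max p.1 q.1) ∧ min p.2 q.2 ≤ x.2 ∧ x.2 ≤ max p.2 q.2 := by
  unfold dist1 at h
  have h1 := abs_sub_le p.1 x.1 q.1
  have h2 := abs_sub_le p.2 x.2 q.2
  exact ⟨between_of_abs_add_le (by linarith), between_of_abs_add_le (by linarith)⟩

/-- A Manhattan path that crosses a vertical line does so between two consecutive points of a row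
of `X`, inside the bounding box of its end points. -/
theorem MConnected.exists_straddle {X : Set (ℝ × ℝ)} (hX : X.Finite) {p q : ℝ × ℝ}
    (h : MConnected X p q) {ρ : ℝ} (hp : p.1 ≤ ρ) (hq : ρ < q.1) :
    ∃ u u', u ∈ X ∧ u' ∈ X ∧ u.2 = u'.2 ∧ min p.2 q.2 ≤ u.2 ∧ u.2 ≤ max p.2 q.2 ∧
      p.1 ≤ u.1 ∧ u.1 ≤ ρ ∧ ρ < u'.1 ∧ u'.1 ≤ q.1 ∧
      ∀ w ∈ X, w.2 = u.2 → w.1 ≤ u.1 ∨ u'.1 ≤ w.1 := by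
  classical
  obtain ⟨m, v, h0, hm, hvX, hv, hs⟩ := h
  have hbox : ∀ i ≤ m, dist1 p (v i) + dist1 (v i) q ≤ dist1 p q := by
    intro i hi
    obtain ⟨j, rfl⟩ := Nat.exists_eq_add_of_le hi
    have h1 := dist1_le_sum v 0 i
    have h2 := dist1_le_sum v i j
    rw [Finset.sum_range_add] at hs
    simp only [zero_add, h0] at h1
    rw [hm] at h2
    linarith
  -- The first vertex beyond the line is entered horizontally; the gap is then shrunk to the points
  -- of that row closest to the line.
  have hex : ∃ i, ρ < (v i).1 := ⟨m, by rw [hm]; exact hq⟩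
  have hle : Nat.find hex ≤ m := Nat.find_min' hex (by rw [hm]; exact hq)
  obtain ⟨i, hi⟩ : ∃ i, Nat.find hex = i + 1 := Nat.exists_eq_succ_of_ne_zero fun h => by
    have := Nat.find_spec hex
    rw [h, h0] at this
    linarith
  have hi1 : ρ < (v (i + 1)).1 := hi ▸ Nat.find_spec hex
  have hi0 : (v i).1 ≤ ρ := not_lt.1 (Nat.find_min hex (by omega))
  have hrow : (v i).2 = (v (i + 1)).2 := (hv i (by omega)).resolve_left fun h => by linarith
  have hpq : p.1 ≤ q.1 := by linarith
  have b0 := mem_box_of_dist1_le (hbox i (by omega))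
  have b1 := mem_box_of_dist1_le (hbox (i + 1) (by omega))
  rw [min_eq_left hpq, max_eq_right hpq] at b0 b1
  obtain ⟨u, ⟨huX, hu2, huρ⟩, hu⟩ := Set.exists_max_image
    {w | w ∈ X ∧ w.2 = (v i).2 ∧ w.1 ≤ ρ} Prod.fst (hX.subset fun w hw => hw.1)
    ⟨v i, hvX i (by omega), rfl, hi0⟩
  obtain ⟨u', ⟨huX', hu2', huρ'⟩, hu'⟩ := Set.exists_min_image
    {w | w ∈ X ∧ w.2 = (v i).2 ∧ ρ < w.1} Prod.fst (hX.subset fun w hw => hw.1)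
    ⟨v (i + 1), hvX (i + 1) (by omega), hrow.symm, hi1⟩
  refine ⟨u, u', huX, huX', hu2.trans hu2'.symm, by rw [hu2]; exact b0.2.1,
    by rw [hu2]; exact b0.2.2, b0.1.1.trans (hu _ ⟨hvX i (by omega), rfl, hi0⟩), huρ, huρ',
    (hu' _ ⟨hvX (i + 1) (by omega), hrow.symm, hi1⟩).trans b1.1.2, fun w hw hw2 => ?_⟩
  rcases le_or_gt w.1 ρ with h | h
  · exact .inl (hu w ⟨hw, hw2.trans hu2, h⟩)
  · exact .inr (hu' w ⟨hw, hw2.trans hu2, h⟩)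

/-! ### Feasible solutions of a layout -/

namespace Layout

variable {ι κ : Type} {L : Layout ι κ}

theorem mconnected_of_upPath {T : Set (ℤ × ℤ)} {X : Set (ℝ × ℝ)}
    (hX : ∀ t ∈ T, GridPoint.toPlane t ∈ X) {a b : ℤ × ℤ} (hb : b ∈ T)
    (h : Relation.ReflTransGen (UpStep T) a b) :
    MConnected X (GridPoint.toPlane a) (GridPoint.toPlane b) := by
  have hle : ∀ {a b : ℤ × ℤ}, a ≤ b → GridPoint.toPlane a ≤ GridPoint.toPlane b := fun h =>
    ⟨Int.cast_le.2 h.1, Int.cast_le.2 h.2⟩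
  suffices MConnected X (GridPoint.toPlane a) (GridPoint.toPlane b) ∧ a ≤ b from this.1
  induction h using Relation.ReflTransGen.head_induction_on with
  | refl => exact ⟨.refl (hX _ hb), le_rfl⟩
  | head hac _ ih =>
    obtain ⟨h1, h2, h3, h4⟩ := hac
    refine ⟨ih.1.cons (hX _ h1) ?_ (dist1_add_of_le (hle h4) (hle ih.2)), le_trans h4 ih.2⟩
    exact h3.imp (fun h => by simp [GridPoint.toPlane, h]) fun h => by simp [GridPoint.toPlane, h]

variable (L)

/-- The position of a point in the plane. -/
def pos (i : ι) : ℝ × ℝ := GridPoint.toPlane (L.X i, L.Y i)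

/-- All pairs of points of different colours are connected in `P ∪ Q`. -/
def Feasible (Q : Finset (ℝ × ℝ)) : Prop :=
  ∀ i j, L.c i ≠ L.c j → MConnected (Set.range L.pos ∪ (Q : Set (ℝ × ℝ))) (L.pos i) (L.pos j)

variable {L}

open Classical in
theorem Feasible.flipX {Q : Finset (ℝ × ℝ)} (h : L.Feasible Q) :
    L.flipX.Feasible (Q.image fun x => (-x.1, x.2)) := by
  intro i j hij
  have := (h i j hij).negX (X' := Set.range L.flipX.pos ∪ ((Q.image fun x => (-x.1, x.2) :
    Finset (ℝ × ℝ)) : Set (ℝ × ℝ))) ?_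
  · simpa [pos, Layout.flipX, GridPoint.toPlane] using this
  · rintro x (⟨r, rfl⟩ | hx)
    · exact .inl ⟨r, by simp [pos, Layout.flipX, GridPoint.toPlane]⟩
    · exact .inr (by simpa using hx)

open Classical in
theorem Feasible.flipY {Q : Finset (ℝ × ℝ)} (h : L.Feasible Q) :
    L.flipY.Feasible (Q.image fun x => (x.1, -x.2)) := by
  intro i j hij
  have := (h i j hij).negY (X' := Set.range L.flipY.pos ∪ ((Q.image fun x => (x.1, -x.2) :
    Finset (ℝ × ℝ)) : Set (ℝ × ℝ))) ?_
  · simpa [pos, Layout.flipY, GridPoint.toPlane] using this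
  · rintro x (⟨r, rfl⟩ | hx)
    · exact .inl ⟨r, by simp [pos, Layout.flipY, GridPoint.toPlane]⟩
    · exact .inr (by simpa using hx)

/-! ### The lower bound -/

/-- For `i < i'`, the common block of `a` and `b` lies inside one block of height `i' * 2 ^ k`,
whose neighbours' boundaries cannot separate them either. -/
theorem lo_le_of_straddle {k i i' : ℕ} {a b a' : ι} {ρ' : ℤ}
    (hhi : L.blk ((i + 1) * 2 ^ k) a = L.blk ((i + 1) * 2 ^ k) b)
    (hρ' : L.IsMax (i' * 2 ^ k) a' ρ') (h1 : L.X a ≤ ρ') (h2 : ρ' < L.X b) : i' ≤ i := by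
  by_contra! h
  have hab := L.blk_mono (Nat.mul_le_mul_right (2 ^ k) h) hhi
  obtain ⟨r, rfl, hr, hm⟩ := hρ'
  have h3 := L.mono (i' * 2 ^ k) _ _ h1
  have h4 := L.mono (i' * 2 ^ k) _ _ h2.le
  have := hm b (by omega)
  omega

theorem blk_eq_of_straddle {s : ℕ} {a a' : ι} {ρ ρ' : ℤ} (hρ : L.IsMax s a ρ)
    (hρ' : L.IsMax s a' ρ') (h1 : L.X a ≤ ρ') (h2 : L.X a' ≤ ρ) : L.blk s a = L.blk s a' := by
  obtain ⟨r, rfl, hr, -⟩ := hρ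
  obtain ⟨r', rfl, hr', -⟩ := hρ'
  have h3 := L.mono s _ _ h1
  have h4 := L.mono s _ _ h2
  omega

/-- Demands that cross the right boundary of a block of height `i * 2 ^ k` inside a block of height
`(i + 1) * 2 ^ k`, with disjoint row ranges for each block, require different points of `Q`. -/
theorem card_le_of_separated [Finite ι] {Q : Finset (ℝ × ℝ)} (hQ : L.Feasible Q) (k : ℕ) {J : Type}
    (F : Finset J) (i : J → ℕ) (a b : J → ι)
    (hc : ∀ j ∈ F, L.c (a j) ≠ L.c (b j))
    (hhi : ∀ j ∈ F, L.blk ((i j + 1) * 2 ^ k) (a j) = L.blk ((i j + 1) * 2 ^ k) (b j))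
    (hlt : ∀ j ∈ F, L.blk (i j * 2 ^ k) (a j) < L.blk (i j * 2 ^ k) (b j))
    (hsep : ∀ j ∈ F, ∀ j' ∈ F, j ≠ j' → i j = i j' →
      L.blk (i j * 2 ^ k) (a j) = L.blk (i j * 2 ^ k) (a j') →
      max (L.Y (a j)) (L.Y (b j)) < min (L.Y (a j')) (L.Y (b j')) ∨
      max (L.Y (a j')) (L.Y (b j')) < min (L.Y (a j)) (L.Y (b j))) :
    F.card ≤ 2 * Q.card := by
  classical
  set X : Set (ℝ × ℝ) := Set.range L.pos ∪ (Q : Set (ℝ × ℝ)) with hXdef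
  have hXfin : X.Finite := (Set.finite_range _).union Q.finite_toSet
  choose ρ hρ using fun j => exists_isMax (L := L) (i j * 2 ^ k) (a j)
  have haρ : ∀ j, L.X (a j) ≤ ρ j := fun j => by
    obtain ⟨r, -, -, hm⟩ := hρ j
    exact hm _ rfl
  have hρb : ∀ j ∈ F, ρ j < L.X (b j) := fun j hj => by
    obtain ⟨r, h1, h2, -⟩ := hρ j
    rw [← h1]
    exact L.lt_of_blk_lt (h2.trans_lt (hlt j hj))
  have key : ∀ j ∈ F, ∃ u u', u ∈ X ∧ u' ∈ X ∧ u.2 = u'.2 ∧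
      min (L.pos (a j)).2 (L.pos (b j)).2 ≤ u.2 ∧ u.2 ≤ max (L.pos (a j)).2 (L.pos (b j)).2 ∧
      (L.pos (a j)).1 ≤ u.1 ∧ u.1 ≤ (ρ j : ℝ) ∧ (ρ j : ℝ) < u'.1 ∧ u'.1 ≤ (L.pos (b j)).1 ∧
      ∀ w ∈ X, w.2 = u.2 → w.1 ≤ u.1 ∨ u'.1 ≤ w.1 := fun j hj =>
    (hQ _ _ (hc j hj)).exists_straddle hXfin (Int.cast_le.2 (haρ j)) (Int.cast_lt.2 (hρb j hj))
  choose! u u' huX huX' hrow hmin hmax hau huρ hρu hub hgap using key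
  -- A common gap straddles both boundaries, which forces equal intervals and equal blocks; its row
  -- lies in both row ranges, against `hsep`.
  have hinj : ∀ j ∈ F, ∀ j' ∈ F, u j = u j' → u' j = u' j' → j = j' := by
    intro j hj j' hj' e e'
    by_contra hne
    have h1 : L.X (a j') ≤ ρ j := Int.cast_le.1 ((e ▸ hau j' hj' : _ ≤ (u j).1).trans (huρ j hj))
    have h2 : L.X (a j) ≤ ρ j' := Int.cast_le.1 ((e ▸ hau j hj : _ ≤ (u j').1).trans (huρ j' hj'))
    have h3 : ρ j < L.X (b j') :=
      Int.cast_lt.1 ((hρu j hj).trans_le (e' ▸ hub j' hj' : (u' j).1 ≤ _))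
    have h4 : ρ j' < L.X (b j) :=
      Int.cast_lt.1 ((hρu j' hj').trans_le (e' ▸ hub j hj : (u' j').1 ≤ _))
    have hii : i j = i j' := le_antisymm
      (lo_le_of_straddle (hhi j' hj') (hρ j) h1 h3) (lo_le_of_straddle (hhi j hj) (hρ j') h2 h4)
    have hblk := blk_eq_of_straddle (hρ j) (hii ▸ hρ j') h2 h1
    have m1 := hmin j hj
    have m2 := hmax j hj
    have m3 := hmin j' hj'
    have m4 := hmax j' hj'
    rw [← e] at m3 m4
    simp only [pos, GridPoint.toPlane, ← Int.cast_min, ← Int.cast_max] at m1 m2 m3 m4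
    have m5 := Int.cast_le.1 (m1.trans m4)
    have m6 := Int.cast_le.1 (m3.trans m2)
    rcases hsep j hj j' hj' hne hii hblk with h | h
    · exact absurd h (not_lt.2 m6)
    · exact absurd h (not_lt.2 m5)
  -- Input points have distinct rows, so the two ends of a gap cannot both be input points.
  have hQ' : ∀ j ∈ F, u j ∉ Q → u' j ∈ Q := by
    intro j hj h
    rcases huX j hj with ⟨r, hr⟩ | h'
    · rcases huX' j hj with ⟨r', hr'⟩ | h'
      · have h1 := hrow j hj
        rw [← hr, ← hr'] at h1
        have h2 : r = r' := L.Y_inj (Int.cast_injective h1)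
        have h3 := (huρ j hj).trans_lt (hρu j hj)
        rw [← hr, ← hr', h2] at h3
        exact absurd h3 (lt_irrefl _)
      · exact h'
    · exact absurd h' h
  -- Gaps contain no further points of their row, so either end determines the other. One end in `Q`
  -- with a bit for its side therefore encodes the gap.
  have hle : ∀ j ∈ F, ∀ j' ∈ F, u j = u j' → (u' j).1 ≤ (u' j').1 := by
    intro j hj j' hj' e
    refine (hgap j hj (u' j') (huX' j' hj') (by rw [← hrow j' hj', e])).resolve_left ?_
    rw [e]
    exact not_le.2 ((huρ j' hj').trans_lt (hρu j' hj'))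
  have hle' : ∀ j ∈ F, ∀ j' ∈ F, u' j = u' j' → (u j').1 ≤ (u j).1 := by
    intro j hj j' hj' e
    refine (hgap j hj (u j') (huX j' hj') (by rw [hrow j' hj', ← e, hrow j hj])).resolve_right ?_
    rw [e]
    exact not_le.2 ((huρ j' hj').trans_lt (hρu j' hj'))
  calc F.card ≤ (Q ×ˢ (Finset.univ : Finset Bool)).card := by
        refine Finset.card_le_card_of_injOn
          (fun j => if u j ∈ Q then (u j, true) else (u' j, false)) ?_ ?_
        · intro j hj
          by_cases h : u j ∈ Q
          · simp [h]
          · simpa [h] using hQ' j hj h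
        · intro j hj j' hj' e
          by_cases h : u j ∈ Q <;> by_cases h' : u j' ∈ Q <;> simp [h, h'] at e
          · exact hinj j hj j' hj' e (Prod.ext (le_antisymm (hle j hj j' hj' e)
              (hle j' hj' j hj e.symm)) (by rw [← hrow j hj, ← hrow j' hj', e]))
          · exact hinj j hj j' hj' (Prod.ext (le_antisymm (hle' j' hj' j hj e.symm)
              (hle' j hj j' hj' e)) (by rw [hrow j hj, hrow j' hj', e])) e
    _ = 2 * Q.card := by simp [Finset.card_product, mul_comm]

/-! ### Counting keys -/

/-- All points of the block of height `hi` in the rows from `s` up to, but excluding, `t` lie on the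
same side of the block of height `lo` as `s`. -/
def OneSided (L : Layout ι κ) (lo hi : ℕ) (z s t : ι) : Prop :=
  ∀ r, L.blk hi r = L.blk hi z → L.Y s ≤ L.Y r → L.Y r < L.Y t →
    (L.blk lo r = L.blk lo z ↔ L.blk lo s = L.blk lo z)

/-- Before row `t`, points on different sides of the block share a colour, since no crossing pair
ends there. Once both sides occur, transitivity makes all colours equal. -/
theorem UpKeyAt.mono_of_not_oneSided {lo hi : ℕ} {z s t : ι} (h : L.UpKeyAt lo hi z s t)
    (h1 : ¬L.OneSided lo hi z s t) {r : ι} (hr : L.blk hi r = L.blk hi z) (hsr : L.Y s ≤ L.Y r)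
    (hrt : L.Y r < L.Y t) : L.c r = L.c s := by
  obtain ⟨hst, hcr, -, -, hno⟩ := h
  have hno' : ∀ x y, L.blk hi x = L.blk hi z → L.blk hi y = L.blk hi z → L.Y s ≤ L.Y x →
      L.Y s ≤ L.Y y → L.Y x < L.Y t → L.Y y < L.Y t →
      ¬(L.blk lo x = L.blk lo z ↔ L.blk lo y = L.blk lo z) → L.c x = L.c y := by
    intro x y hx hy h1 h2 h3 h4 h5
    by_contra hne
    rcases lt_trichotomy (L.Y x) (L.Y y) with h | h | h
    · exact hno x y h1 h h4 ⟨hx, hy, h5, hne⟩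
    · exact hne (by rw [L.Y_inj h])
    · exact hno y x h2 h h3 ⟨hy, hx, fun h => h5 h.symm, Ne.symm hne⟩
  unfold OneSided at h1
  push Not at h1
  obtain ⟨r₀, hr₀, hsr₀, hrt₀, hside⟩ := h1
  have hs : ¬(L.blk lo r₀ = L.blk lo z ↔ L.blk lo s = L.blk lo z) := by tauto
  have h0 : L.c r₀ = L.c s := hno' r₀ s hr₀ hcr.1 hsr₀ le_rfl hrt₀ hst hs
  by_cases hr' : L.blk lo r = L.blk lo z ↔ L.blk lo s = L.blk lo z
  · exact (hno' r r₀ hr hr₀ hsr hsr₀ hrt hrt₀ (by tauto)).trans h0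
  · exact hno' r s hr hcr.1 hsr le_rfl hrt hst hr'

/-- Suppose `s'` is not above `t`. Minimality of `t'` puts `s` below `s'`, and `t`, `s'` are on
opposite sides. One-sidedness of the second pair forbids this; otherwise `s`, `s'` and `t` all get
the same colour, although `(s, t)` crosses. -/
theorem UpKeyAt.lt_of_lt {lo hi : ℕ} (hlh : lo ≤ hi) {z s t z' s' t' : ι}
    (h : L.UpKeyAt lo hi z s t) (h' : L.UpKeyAt lo hi z' s' t') (hz : L.blk lo z = L.blk lo z')
    (hside : L.blk lo t = L.blk lo z ↔ L.blk lo t' = L.blk lo z')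
    (htype : L.OneSided lo hi z s t ↔ L.OneSided lo hi z' s' t') (htt : L.Y t < L.Y t') :
    L.Y t < L.Y s' := by
  have hzhi := L.blk_mono hlh hz
  by_contra! hst
  have hcr := h.2.1
  have hcr' := h'.2.1
  have hss : L.Y s < L.Y s' := by
    by_contra! hle
    exact h'.2.2.2.2 s t hle h.1 htt ((cross_congr hz hzhi).1 hcr)
  have hside' : ¬(L.blk lo t = L.blk lo z' ↔ L.blk lo s' = L.blk lo z') := by
    have := hcr'.2.2.1
    rw [hz] at hside
    tauto
  by_cases h1 : L.OneSided lo hi z s t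
  · exact hside' (htype.1 h1 t (hcr.2.1.trans hzhi) hst htt)
  · rcases hst.lt_or_eq with hlt | heq
    · have e1 := h.mono_of_not_oneSided h1 (hcr'.1.trans hzhi.symm) hss.le hlt
      have e2 := h'.mono_of_not_oneSided (fun h2 => h1 (htype.2 h2)) (hcr.2.1.trans hzhi) hst htt
      exact hcr.2.2.2 (e1.symm.trans e2.symm)
    · rw [L.Y_inj heq] at hside'
      exact hside' Iff.rfl

theorem UpKeyAt.separated {lo hi : ℕ} (hlh : lo ≤ hi) {z s t z' s' t' : ι}
    (h : L.UpKeyAt lo hi z s t) (h' : L.UpKeyAt lo hi z' s' t') (hz : L.blk lo z = L.blk lo z')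
    (hside : L.blk lo t = L.blk lo z ↔ L.blk lo t' = L.blk lo z')
    (htype : L.OneSided lo hi z s t ↔ L.OneSided lo hi z' s' t') (hne : z ≠ z') :
    L.Y t < L.Y s' ∨ L.Y t' < L.Y s := by
  rcases lt_trichotomy (L.Y t) (L.Y t') with hlt | heq | hlt
  · exact .inl (h.lt_of_lt hlh h' hz hside htype hlt)
  · refine absurd (L.Y_inj (le_antisymm ?_ ?_)) hne
    · exact h'.2.2.2.1 z hz (heq ▸ h.2.2.1)
    · exact h.2.2.2.1 z' hz.symm (heq ▸ h'.2.2.1)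
  · exact .inr (h'.lt_of_lt hlh h hz.symm hside.symm htype.symm hlt)

/-- `α` tells which end of the pair is inside the block, and `hlt` puts the other end to its right.
Oriented from inside to outside, the pairs are separated demands across right boundaries. -/
theorem card_keys_le_of_class [Finite ι] {Q : Finset (ℝ × ℝ)} (hQ : L.Feasible Q) (k : ℕ)
    (S : Finset (ℕ × ι)) (s t : ℕ × ι → ι)
    (hS : ∀ x ∈ S, L.UpKeyAt (x.1 * 2 ^ k) ((x.1 + 1) * 2 ^ k) x.2 (s x) (t x)) (α β : Prop)
    (hα : ∀ x ∈ S, (L.blk (x.1 * 2 ^ k) (t x) = L.blk (x.1 * 2 ^ k) x.2 ↔ α))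
    (hβ : ∀ x ∈ S, (L.OneSided (x.1 * 2 ^ k) ((x.1 + 1) * 2 ^ k) x.2 (s x) (t x) ↔ β))
    (hlt : ∀ x ∈ S, (α ∧ L.blk (x.1 * 2 ^ k) (t x) < L.blk (x.1 * 2 ^ k) (s x)) ∨
      (¬α ∧ L.blk (x.1 * 2 ^ k) (s x) < L.blk (x.1 * 2 ^ k) (t x))) :
    S.card ≤ 2 * Q.card := by
  classical
  have hsep : ∀ x ∈ S, ∀ y ∈ S, x ≠ y → x.1 = y.1 →
      L.blk (x.1 * 2 ^ k) x.2 = L.blk (x.1 * 2 ^ k) y.2 →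
      L.Y (t x) < L.Y (s y) ∨ L.Y (t y) < L.Y (s x) := by
    intro x hx y hy hxy hi hblk
    have hy' := hS y hy
    have a1 := hα y hy
    have a2 := hβ y hy
    rw [← hi] at hy' a1 a2
    exact (hS x hx).separated (Nat.mul_le_mul_right _ (Nat.le_succ _)) hy' hblk
      ((hα x hx).trans a1.symm) ((hβ x hx).trans a2.symm) fun h => hxy (Prod.ext hi h)
  by_cases hA : α
  · simp only [hA, iff_true, true_and, not_true_eq_false, false_and, or_false] at hα hlt
    refine card_le_of_separated hQ k S Prod.fst t s (fun x hx => (hS x hx).2.1.2.2.2.symm)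
      (fun x hx => (hS x hx).2.1.2.1.trans (hS x hx).2.1.1.symm) hlt fun x hx y hy hxy hi hblk => ?_
    have h1 := (hS x hx).1
    have h2 := (hS y hy).1
    have h3 := hα y hy
    rw [← hi] at h3
    rw [hα x hx, h3] at hblk
    rw [max_eq_left h1.le, max_eq_left h2.le, min_eq_right h1.le, min_eq_right h2.le]
    exact hsep x hx y hy hxy hi hblk
  · simp only [hA, iff_false, false_and, not_false_eq_true, true_and, false_or] at hα hlt
    refine card_le_of_separated hQ k S Prod.fst s t (fun x hx => (hS x hx).2.1.2.2.2)
      (fun x hx => (hS x hx).2.1.1.trans (hS x hx).2.1.2.1.symm) hlt fun x hx y hy hxy hi hblk => ?_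
    have h1 := (hS x hx).1
    have h2 := (hS y hy).1
    have e1 : L.blk (x.1 * 2 ^ k) (s x) = L.blk (x.1 * 2 ^ k) x.2 := by
      have := (hS x hx).2.1.2.2.1
      have := hα x hx
      tauto
    have e2 : L.blk (x.1 * 2 ^ k) (s y) = L.blk (x.1 * 2 ^ k) y.2 := by
      have := (hS y hy).2.1.2.2.1
      have := hα y hy
      rw [hi]
      tauto
    rw [e1, e2] at hblk
    rw [max_eq_right h1.le, max_eq_right h2.le, min_eq_left h1.le, min_eq_left h2.le]
    exact hsep x hx y hy hxy hi hblk

theorem oneSided_flipX {lo hi : ℕ} {z s t : ι} :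
    L.flipX.OneSided lo hi z s t ↔ L.OneSided lo hi z s t := by
  simp [OneSided, flipX]

theorem card_keys_le_of_type [Finite ι] {Q : Finset (ℝ × ℝ)} (hQ : L.Feasible Q) (k : ℕ)
    (S : Finset (ℕ × ι)) (s t : ℕ × ι → ι)
    (hS : ∀ x ∈ S, L.UpKeyAt (x.1 * 2 ^ k) ((x.1 + 1) * 2 ^ k) x.2 (s x) (t x)) (α β : Prop)
    (hα : ∀ x ∈ S, (L.blk (x.1 * 2 ^ k) (t x) = L.blk (x.1 * 2 ^ k) x.2 ↔ α))
    (hβ : ∀ x ∈ S, (L.OneSided (x.1 * 2 ^ k) ((x.1 + 1) * 2 ^ k) x.2 (s x) (t x) ↔ β)) :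
    S.card ≤ 4 * Q.card := by
  classical
  set right : ℕ × ι → Prop := fun x =>
    (α ∧ L.blk (x.1 * 2 ^ k) (t x) < L.blk (x.1 * 2 ^ k) (s x)) ∨
      (¬α ∧ L.blk (x.1 * 2 ^ k) (s x) < L.blk (x.1 * 2 ^ k) (t x)) with hright
  have hne : ∀ x ∈ S, L.blk (x.1 * 2 ^ k) (t x) ≠ L.blk (x.1 * 2 ^ k) (s x) := by
    intro x hx h
    exact (hS x hx).2.1.2.2.1 (by rw [h])
  have h1 : (S.filter right).card ≤ 2 * Q.card := by
    refine card_keys_le_of_class hQ k _ s t (fun x hx => hS x (Finset.mem_filter.1 hx).1) α β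
      (fun x hx => hα x (Finset.mem_filter.1 hx).1) (fun x hx => hβ x (Finset.mem_filter.1 hx).1)
      fun x hx => (Finset.mem_filter.1 hx).2
  have h2 : (S.filter fun x => ¬right x).card ≤ 2 * Q.card := by
    refine (card_keys_le_of_class hQ.flipX k _ s t
      (fun x hx => upKeyAt_flipX.2 (hS x (Finset.mem_filter.1 hx).1)) α β
      (fun x hx => neg_inj.trans (hα x (Finset.mem_filter.1 hx).1))
      (fun x hx => oneSided_flipX.trans (hβ x (Finset.mem_filter.1 hx).1)) fun x hx => ?_).trans
      (Nat.mul_le_mul_left _ Finset.card_image_le)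
    have h3 := hne x (Finset.mem_filter.1 hx).1
    have h4 := (Finset.mem_filter.1 hx).2
    by_cases hA : α
    · simp only [hright, hA, true_and, not_true_eq_false, false_and, or_false, flipX] at h4 ⊢
      omega
    · simp only [hright, hA, false_and, not_false_eq_true, true_and, false_or, flipX] at h4 ⊢
      omega
  have := Finset.card_filter_add_card_filter_not (s := S) right
  omega

/-- Four types, each bounded by `4 * |Q|`: the right-going half directly and the left-going half by
reflection. -/
theorem card_keys_le [Finite ι] {Q : Finset (ℝ × ℝ)} (hQ : L.Feasible Q) (k : ℕ)
    (S : Finset (ℕ × ι)) (hS : ∀ x ∈ S, L.UpKey (x.1 * 2 ^ k) ((x.1 + 1) * 2 ^ k) x.2) :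
    S.card ≤ 16 * Q.card := by
  classical
  rcases isEmpty_or_nonempty ι with h | h
  · simp [Finset.eq_empty_of_isEmpty S]
  choose! s t hst using hS
  set A : ℕ × ι → Prop := fun x => L.blk (x.1 * 2 ^ k) (t x) = L.blk (x.1 * 2 ^ k) x.2
  set B : ℕ × ι → Prop := fun x => L.OneSided (x.1 * 2 ^ k) ((x.1 + 1) * 2 ^ k) x.2 (s x) (t x)
  have key : ∀ α β : Prop, ∃ F : Finset (ℕ × ι), F.card ≤ 4 * Q.card ∧
      ∀ x ∈ S, (A x ↔ α) → (B x ↔ β) → x ∈ F := by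
    intro α β
    refine ⟨S.filter fun x => (A x ↔ α) ∧ (B x ↔ β), ?_, fun x hx ha hb => by simp [hx, ha, hb]⟩
    exact card_keys_le_of_type hQ k _ s t (fun x hx => hst x (Finset.mem_filter.1 hx).1) α β
      (fun x hx => (Finset.mem_filter.1 hx).2.1) (fun x hx => (Finset.mem_filter.1 hx).2.2)
  obtain ⟨F₁, c₁, h₁⟩ := key True True
  obtain ⟨F₂, c₂, h₂⟩ := key True False
  obtain ⟨F₃, c₃, h₃⟩ := key False True
  obtain ⟨F₄, c₄, h₄⟩ := key False False
  have hsub : S ⊆ F₁ ∪ F₂ ∪ (F₃ ∪ F₄) := by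
    intro x hx
    have h₁ := h₁ x hx
    have h₂ := h₂ x hx
    have h₃ := h₃ x hx
    have h₄ := h₄ x hx
    simp only [Finset.mem_union]
    tauto
  have e₀ := Finset.card_le_card hsub
  have e₁ := Finset.card_union_le F₁ F₂
  have e₂ := Finset.card_union_le F₃ F₄
  have e₃ := Finset.card_union_le (F₁ ∪ F₂) (F₃ ∪ F₄)
  omega

/-! ### Counting the projections of the keys -/

variable (L) in
/-- The projections of the keys of level `k`. -/
def levelSet (H k : ℕ) : Set (ℤ × ℤ) :=
  {p | ∃ i, (i + 1) * 2 ^ k ≤ H ∧ ∃ z, L.UpKey (i * 2 ^ k) ((i + 1) * 2 ^ k) z ∧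
    ∃ m, (m = i * 2 ^ k ∨ m = i * 2 ^ k + 2 ^ k / 2) ∧ L.Bd m z p.1 ∧ p.2 = L.Y z}

theorem setOf_bd (m : ℕ) (z : ι) :
    ∃ B : Finset ℤ, B.card ≤ 4 ∧ ∀ x, L.Bd m z x → x ∈ B := by
  have sub : ∀ p : ℤ → Prop, (∀ x y, p x → p y → x = y) →
      ∃ B : Finset ℤ, B.card ≤ 1 ∧ ∀ x, p x → x ∈ B := by
    intro p hp
    by_cases h : ∃ x, p x
    · obtain ⟨x, hx⟩ := h
      exact ⟨{x}, by simp, fun y hy => by simp [hp y x hy hx]⟩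
    · exact ⟨∅, by simp, fun x hx => absurd ⟨x, hx⟩ h⟩
  obtain ⟨B₁, c₁, h₁⟩ := sub (L.IsMax m z) fun x y hx hy => by
    obtain ⟨i, rfl, hi, hm⟩ := hx
    obtain ⟨j, rfl, hj, hm'⟩ := hy
    exact le_antisymm (hm' i hi) (hm j hj)
  obtain ⟨B₂, c₂, h₂⟩ := sub (L.IsMin m z) fun x y hx hy => by
    obtain ⟨i, rfl, hi, hm⟩ := hx
    obtain ⟨j, rfl, hj, hm'⟩ := hy
    exact le_antisymm (hm j hj) (hm' i hi)
  obtain ⟨B₃, c₃, h₃⟩ := sub (L.IsNext m z) fun x y hx hy => by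
    obtain ⟨i, rfl, hi, hm⟩ := hx
    obtain ⟨j, rfl, hj, hm'⟩ := hy
    exact le_antisymm (hm j hj) (hm' i hi)
  obtain ⟨B₄, c₄, h₄⟩ := sub (L.IsPrev m z) fun x y hx hy => by
    obtain ⟨i, rfl, hi, hm⟩ := hx
    obtain ⟨j, rfl, hj, hm'⟩ := hy
    exact le_antisymm (hm' i hi) (hm j hj)
  refine ⟨B₁ ∪ B₂ ∪ (B₃ ∪ B₄), ?_, fun x hx => ?_⟩
  · have e₁ := Finset.card_union_le B₁ B₂
    have e₂ := Finset.card_union_le B₃ B₄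
    have e₃ := Finset.card_union_le (B₁ ∪ B₂) (B₃ ∪ B₄)
    omega
  · simp only [Finset.mem_union]
    rcases hx with hx | hx | hx | hx
    · exact .inl (.inl (h₁ x hx))
    · exact .inl (.inr (h₂ x hx))
    · exact .inr (.inl (h₃ x hx))
    · exact .inr (.inr (h₄ x hx))

theorem exists_finset_levelSet [Finite ι] {Q : Finset (ℝ × ℝ)} (hQ : L.Feasible Q) (H k : ℕ) :
    ∃ F : Finset (ℤ × ℤ), L.levelSet H k ⊆ F ∧ F.card ≤ 128 * Q.card := by
  classical
  have := Fintype.ofFinite ι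
  choose B hB hBd using setOf_bd (L := L)
  set S : Finset (ℕ × ι) := (Finset.range H ×ˢ Finset.univ).filter fun x =>
    L.UpKey (x.1 * 2 ^ k) ((x.1 + 1) * 2 ^ k) x.2 with hSdef
  have hS := card_keys_le hQ k S fun x hx => (Finset.mem_filter.1 hx).2
  refine ⟨S.biUnion fun x => (B (x.1 * 2 ^ k) x.2 ∪ B (x.1 * 2 ^ k + 2 ^ k / 2) x.2).image
    fun y => (y, L.Y x.2), ?_, ?_⟩
  · rintro ⟨x, y⟩ ⟨i, hi, z, hz, m, hm, hbd, rfl⟩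
    simp only [Finset.coe_biUnion, Set.mem_iUnion]
    have hiH : i < H := by
      have : i + 1 ≤ (i + 1) * 2 ^ k := Nat.le_mul_of_pos_right _ (by positivity)
      omega
    refine ⟨(i, z), by simp [hSdef, hiH, hz], ?_⟩
    simp only [Finset.coe_image, Set.mem_image, Finset.mem_coe, Finset.mem_union]
    refine ⟨x, ?_, rfl⟩
    rcases hm with rfl | rfl
    · exact .inl (hBd _ _ _ hbd)
    · exact .inr (hBd _ _ _ hbd)
  -- Two heights with four boundary columns each give `8` projections per key, and `8 * 16 = 128`.
  · refine (Finset.card_biUnion_le_card_mul _ _ 8 fun x _ => ?_).trans (by omega)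
    refine Finset.card_image_le.trans ((Finset.card_union_le _ _).trans ?_)
    have h1 := hB (x.1 * 2 ^ k) x.2
    have h2 := hB (x.1 * 2 ^ k + 2 ^ k / 2) x.2
    omega

/-- The projections of all keys are few. -/
theorem exists_finset_levelSets [Finite ι] {Q : Finset (ℝ × ℝ)} (hQ : L.Feasible Q) (H : ℕ) :
    ∃ F : Finset (ℤ × ℤ), (∀ k, L.levelSet H k ⊆ F) ∧ F.card ≤ H.size * (128 * Q.card) := by
  classical
  choose F hF hcard using exists_finset_levelSet hQ H
  refine ⟨(Finset.range H.size).biUnion F, fun k p hp => ?_, ?_⟩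
  · have hk : 2 ^ k ≤ H := by
      obtain ⟨i, hi, -⟩ := hp
      exact (Nat.le_mul_of_pos_left _ (Nat.succ_pos i)).trans hi
    simp only [Finset.coe_biUnion, Set.mem_iUnion]
    exact ⟨k, by simpa using Nat.lt_size.2 hk, hF k hp⟩
  · simpa using Finset.card_biUnion_le_card_mul (Finset.range H.size) F _ fun k _ => hcard k

theorem covers_iff {H : ℕ} {T : Set (ℤ × ℤ)} : L.Covers H T ↔ ∀ k, L.levelSet H k ⊆ T := by
  constructor
  · rintro h k ⟨x, y⟩ ⟨i, hi, z, hz, m, hm, hbd, rfl⟩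
    exact h k i hi z hz m hm x hbd
  · intro h k i hi z hz m hm x hbd
    exact h k ⟨i, hi, z, hz, m, hm, hbd, rfl⟩

/-- A set that covers the keys of a layout and of its reflection connects all demands. -/
theorem mconnected_of_covers [Finite ι] {H K : ℕ} {T : Set (ℤ × ℤ)} (hT : L.Covers H T)
    (hT' : L.flipY.Covers H {p | (p.1, -p.2) ∈ T}) (hP : ∀ i, (L.X i, L.Y i) ∈ T)
    (hK : 2 ^ K ≤ H) (htop : ∀ i j, L.blk (2 ^ K) i = L.blk (2 ^ K) j) {X : Set (ℝ × ℝ)}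
    (hX : ∀ t ∈ T, GridPoint.toPlane t ∈ X) {p q : ι} (hc : L.c p ≠ L.c q) :
    MConnected X (L.pos p) (L.pos q) := by
  have key : ∀ p q, L.X p < L.X q → L.c p ≠ L.c q → MConnected X (L.pos p) (L.pos q) := by
    intro p q hpq hc
    rcases lt_trichotomy (L.Y p) (L.Y q) with h | h | h
    · exact mconnected_of_upPath hX (hP q) (exists_upPath hT hT' hP hK htop hpq h hc)
    · exact absurd (congrArg L.c (L.Y_inj h)) hc
    · have path := exists_upPath (L := L.flipY) (T := {p | (p.1, -p.2) ∈ T}) hT'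
        (by simpa [Layout.flipY] using hT) (by simpa [Layout.flipY] using hP) hK htop hpq
        (neg_lt_neg h) hc
      have := (mconnected_of_upPath (X := {x | (x.1, -x.2) ∈ X})
        (fun t ht => by simpa [GridPoint.toPlane] using hX _ ht)
        (by simpa [Layout.flipY] using hP q) path).negY (X' := X) fun x hx => hx
      simpa [Layout.flipY, GridPoint.toPlane, pos] using this
  rcases lt_trichotomy (L.X p) (L.X q) with h | h | h
  · exact key p q h hc
  · refine MConnected.cons (hX _ (hP p)) (.inl (by simp [pos, GridPoint.toPlane, h])) ?_
      (.refl (hX _ (hP q)))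
    simp [dist1]
  · exact (key q p h hc.symm).symm

end Layout

end Manhattan

namespace Manhattan

open Enc (enc)

/-! ### The algorithm -/

section Algorithm

/-- The number of points to the left of the column `x`. -/
def rank (P : List (ℤ × ℤ)) (x : ℤ) : ℤ :=
  P.foldl (fun acc p => bif decide (p.1 < x) then acc + 1 else acc) 0

/-- The quotient of `r` by `u`, computed by at most `P.length` subtractions. -/
def quot (P : List (ℤ × ℤ)) (r u : ℤ) : ℤ :=
  (P.foldl (fun (acc : ℤ × ℤ) _ => bif decide (u ≤ acc.1) then (acc.1 - u, acc.2 + 1) else acc)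
    (r, 0)).2

/-- Do the columns `x` and `y` belong to the same block of `u` consecutive ranks? -/
def sameBlock (P : List (ℤ × ℤ)) (u x y : ℤ) : Bool :=
  decide (quot P (rank P x) u = quot P (rank P y) u)

/-- Is the block of `x` to the left of the block of `y`? -/
def blockLt (P : List (ℤ × ℤ)) (u x y : ℤ) : Bool :=
  decide (quot P (rank P x) u < quot P (rank P y) u)

def pointEq (p q : ℤ × ℤ) : Bool := decide (p.1 = q.1) && decide (p.2 = q.2)

def isDemand (D : List ((ℤ × ℤ) × (ℤ × ℤ))) (p q : ℤ × ℤ) : Bool :=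
  D.any fun d => (pointEq d.1 p && pointEq d.2 q) || (pointEq d.1 q && pointEq d.2 p)

def crossTest (P : List (ℤ × ℤ)) (D : List ((ℤ × ℤ) × (ℤ × ℤ))) (lo hi : ℤ) (z s t : ℤ × ℤ) : Bool :=
  sameBlock P hi s.1 z.1 && (sameBlock P hi t.1 z.1 &&
    (!(sameBlock P lo s.1 z.1 == sameBlock P lo t.1 z.1) && isDemand D s t))

def keyTest (P : List (ℤ × ℤ)) (D : List ((ℤ × ℤ) × (ℤ × ℤ))) (lo hi : ℤ) (z : ℤ × ℤ) : Bool :=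
  P.any fun s => P.any fun t => decide (s.2 < t.2) && (crossTest P D lo hi z s t &&
    (decide (z.2 < t.2) &&
      ((P.all fun z' => !sameBlock P lo z'.1 z.1 || (!decide (z'.2 < t.2) || decide (z'.2 ≤ z.2))) &&
        P.all fun s' => P.all fun t' => !decide (s.2 ≤ s'.2) || (!decide (s'.2 < t'.2) ||
          (!decide (t'.2 < t.2) || !crossTest P D lo hi z s' t')))))

/-- In order: last column, first column, next column, previous column. -/
def boundaryTest (P : List (ℤ × ℤ)) (m : ℤ) (z i : ℤ × ℤ) : Bool :=
  (sameBlock P m i.1 z.1 && P.all fun j => !sameBlock P m j.1 z.1 || decide (j.1 ≤ i.1)) ||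
  ((sameBlock P m i.1 z.1 && P.all fun j => !sameBlock P m j.1 z.1 || decide (i.1 ≤ j.1)) ||
  ((blockLt P m z.1 i.1 && P.all fun j => !blockLt P m z.1 j.1 || decide (i.1 ≤ j.1)) ||
  (blockLt P m i.1 z.1 && P.all fun j => !blockLt P m j.1 z.1 || decide (j.1 ≤ i.1))))

/-- The projections of the keys for consecutive block sizes `lo`, `hi` of the list `A`. -/
def levelPoints (P : List (ℤ × ℤ)) (D : List ((ℤ × ℤ) × (ℤ × ℤ))) (A' A : List ℤ) : List (ℤ × ℤ) :=
  A.flatMap fun lo =>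
    (A.filter fun hi => decide (lo < hi) && A.all fun w => decide (w ≤ lo) || decide (hi ≤ w)).flatMap
      fun hi => (A'.filter fun m => decide (lo ≤ m) && decide (m < hi)).flatMap fun m =>
        (P.filter fun z => keyTest P D lo hi z).flatMap fun z =>
          (P.filter fun i => boundaryTest P m z i).map fun i => (i.1, z.2)

/-- Is the number of elements below `x` even? -/
def evenBelow (A : List ℤ) (x : ℤ) : Bool :=
  A.foldl (fun acc y => bif decide (y < x) then !acc else acc) true

/-- Every other element of `A` in increasing order. -/
def thin (A : List ℤ) : List ℤ := A.filter fun x => evenBelow A x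

def len (P : List (ℤ × ℤ)) : ℤ := P.foldl (fun acc _ => acc + 1) 0

/-- `n ^ 2 + 1`, where `n` is the number of points. -/
def sizeBound (P : List (ℤ × ℤ)) : ℤ := P.foldl (fun acc _ => acc + len P) 1

/-- The powers of two up to `n ^ 2 + 1`. -/
def powers (P : List (ℤ × ℤ)) : List ℤ :=
  (((0, 0) :: (P ++ P)).foldl (fun (acc : ℤ × List ℤ) _ => (acc.1 + acc.1, acc.1 :: acc.2)) (1, [])).2.filter
    fun u => decide (u ≤ sizeBound P)

/-- The accumulator holds the scale of the previous level, which supplies the midpoints, the current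
scale, and the output so far. -/
def levelStep (P : List (ℤ × ℤ)) (D : List ((ℤ × ℤ) × (ℤ × ℤ)))
    (acc : List ℤ × (List ℤ × List (ℤ × ℤ))) : List ℤ × (List ℤ × List (ℤ × ℤ)) :=
  (acc.2.1, (thin acc.2.1, acc.2.2 ++ levelPoints P D acc.1 acc.2.1))

/-- The projections of the keys of all levels. -/
def keyPoints (P : List (ℤ × ℤ)) (D : List ((ℤ × ℤ) × (ℤ × ℤ))) : List (ℤ × ℤ) :=
  ((powers P).foldl (fun acc _ => levelStep P D acc) (powers P, (powers P, []))).2.2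

def negRow (p : ℤ × ℤ) : ℤ × ℤ := (p.1, 0 - p.2)

/-- The approximation algorithm: the key projections of the instance and of its reflection. -/
def algorithm (I : List (ℤ × ℤ) × List ((ℤ × ℤ) × (ℤ × ℤ))) : List (ℤ × ℤ) :=
  keyPoints I.1 I.2 ++
    (keyPoints (I.1.map fun p => negRow p) (I.2.map fun d => (negRow d.1, negRow d.2))).map
      fun p => negRow p

end Algorithm

/-! ### The algorithm runs in polynomial time -/

section Time

variable {α β E : Type} [Enc α] [Enc β] [Enc E]

/-- The growth per round depends on the environment only, so polynomially many rounds stay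
polynomial. -/
theorem PTime.foldl_of_growth {g : E → β → α → β} {b : E → β} {l : E → List α}
    (hg : PTime fun x : E × (β × α) => g x.1 x.2.1 x.2.2) (hb : PTime b) (hl : PTime l)
    (hq : ∃ q : Polynomial ℕ, ∀ e acc a, sz (g e acc a) ≤ sz acc + q.eval (sz e)) :
    PTime fun e => (l e).foldl (g e) (b e) := by
  obtain ⟨q, hq⟩ := hq
  obtain ⟨r, hr⟩ := hl.size_le
  obtain ⟨p, hp⟩ := hb.size_le
  refine hg.foldl hb hl ⟨p + r * q, fun e l' hl' => ?_⟩
  have h : ∀ (l : List α) (acc : β), sz (l.foldl (g e) acc) ≤ sz acc + l.length * q.eval (sz e) := by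
    intro l
    induction l with
    | nil => simp
    | cons a l ih =>
      intro acc
      have h1 := ih (g e acc a)
      have h2 := hq e acc a
      rw [List.foldl_cons, List.length_cons, Nat.succ_mul]
      omega
  have h1 := h l' (b e)
  have h2 : l'.length ≤ r.eval (sz e) := hl'.length_le.trans ((length_le_sz _).trans (hr e))
  have h3 := Nat.mul_le_mul_right (q.eval (sz e)) h2
  have h4 := hp e
  simp only [Polynomial.eval_add, Polynomial.eval_mul]
  omega

theorem sz_one_int : sz (1 : ℤ) = 2 := by simp [sz_int]

theorem PTime.rank {P : E → List (ℤ × ℤ)} {x : E → ℤ} (hP : PTime P) (hx : PTime x) :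
    PTime fun e => rank (P e) (x e) := by
  refine PTime.foldl_of_growth (g := fun e acc p => bif decide (p.1 < x e) then acc + 1 else acc)
    ?_ (.const 0) hP ⟨.C 3, fun e acc p => ?_⟩
  · exact .cond (.lt (.fst (.snd (.snd .id))) (hx.comp (.fst .id)))
      (.add (.fst (.snd .id)) (.const 1)) (.fst (.snd .id))
  · have := sz_add_le acc 1
    rw [sz_one_int] at this
    rw [Polynomial.eval_C]
    cases decide (p.1 < x e)
    · rw [cond_false]; omega
    · rw [cond_true]; omega

theorem sz_sub_le (a b : ℤ) : sz (a - b) ≤ 1 + sz a + sz b := by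
  have := sz_add_le a (-b)
  rwa [← sub_eq_add_neg, sz_int (-b), Int.natAbs_neg, ← sz_int] at this

theorem PTime.quot {P : E → List (ℤ × ℤ)} {r u : E → ℤ} (hP : PTime P) (hr : PTime r)
    (hu : PTime u) : PTime fun e => quot (P e) (r e) (u e) := by
  obtain ⟨q, hq⟩ := hu.size_le
  refine PTime.snd (PTime.foldl_of_growth
    (g := fun e acc _ => bif decide (u e ≤ acc.1) then (acc.1 - u e, acc.2 + 1) else acc)
    ?_ (hr.pair (.const 0)) hP ⟨q + 4, fun e acc p => ?_⟩)
  · exact .cond (.le (hu.comp (.fst .id)) (.fst (.fst (.snd .id))))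
      (.pair (.sub (.fst (.fst (.snd .id))) (hu.comp (.fst .id)))
        (.add (.snd (.fst (.snd .id))) (.const 1))) (.fst (.snd .id))
  · have h1 := sz_add_le acc.2 1
    have h2 := sz_sub_le acc.1 (u e)
    have h3 := hq e
    have h4 : Polynomial.eval (sz e) (4 : Polynomial ℕ) = 4 := by simp
    rw [sz_one_int] at h1
    rw [Polynomial.eval_add, h4]
    cases decide (u e ≤ acc.1)
    · rw [cond_false]; omega
    · rw [cond_true, sz_pair, sz_pair acc]; dsimp only; omega

theorem PTime.sameBlock {P : E → List (ℤ × ℤ)} {u x y : E → ℤ} (hP : PTime P) (hu : PTime u)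
    (hx : PTime x) (hy : PTime y) : PTime fun e => sameBlock (P e) (u e) (x e) (y e) :=
  .eq_int (.quot hP (.rank hP hx) hu) (.quot hP (.rank hP hy) hu)

theorem PTime.blockLt {P : E → List (ℤ × ℤ)} {u x y : E → ℤ} (hP : PTime P) (hu : PTime u)
    (hx : PTime x) (hy : PTime y) : PTime fun e => blockLt (P e) (u e) (x e) (y e) :=
  .lt (.quot hP (.rank hP hx) hu) (.quot hP (.rank hP hy) hu)

theorem PTime.pointEq {p q : E → ℤ × ℤ} (hp : PTime p) (hq : PTime q) :
    PTime fun e => pointEq (p e) (q e) :=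
  .and (.eq_int (.fst hp) (.fst hq)) (.eq_int (.snd hp) (.snd hq))

theorem PTime.isDemand {D : E → List ((ℤ × ℤ) × (ℤ × ℤ))} {p q : E → ℤ × ℤ} (hD : PTime D)
    (hp : PTime p) (hq : PTime q) : PTime fun e => isDemand (D e) (p e) (q e) := by
  have hp' := hp.comp (PTime.fst' (α := E) (β := (ℤ × ℤ) × (ℤ × ℤ)))
  have hq' := hq.comp (PTime.fst' (α := E) (β := (ℤ × ℤ) × (ℤ × ℤ)))
  exact .any hD (.or (.and (.pointEq (.fst (.snd .id)) hp') (.pointEq (.snd (.snd .id)) hq'))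
    (.and (.pointEq (.fst (.snd .id)) hq') (.pointEq (.snd (.snd .id)) hp')))

theorem PTime.crossTest {P : E → List (ℤ × ℤ)} {D : E → List ((ℤ × ℤ) × (ℤ × ℤ))} {lo hi : E → ℤ}
    {z s t : E → ℤ × ℤ} (hP : PTime P) (hD : PTime D) (hlo : PTime lo) (hhi : PTime hi)
    (hz : PTime z) (hs : PTime s) (ht : PTime t) :
    PTime fun e => crossTest (P e) (D e) (lo e) (hi e) (z e) (s e) (t e) :=
  .and (.sameBlock hP hhi hs.fst hz.fst) (.and (.sameBlock hP hhi ht.fst hz.fst)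
    (.and (.not (.beq_bool (.sameBlock hP hlo hs.fst hz.fst) (.sameBlock hP hlo ht.fst hz.fst)))
      (.isDemand hD hs ht)))

theorem PTime.keyTest {P : E → List (ℤ × ℤ)} {D : E → List ((ℤ × ℤ) × (ℤ × ℤ))} {lo hi : E → ℤ}
    {z : E → ℤ × ℤ} (hP : PTime P) (hD : PTime D) (hlo : PTime lo) (hhi : PTime hi)
    (hz : PTime z) : PTime fun e => keyTest (P e) (D e) (lo e) (hi e) (z e) := by
  have lift : ∀ {α : Type} [Enc α] {f : E → α}, PTime f →
      PTime fun x : (E × (ℤ × ℤ)) × (ℤ × ℤ) => f x.1.1 := fun hf => hf.comp (.fst (.fst .id))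
  refine .any hP (.any (hP.comp (.fst .id)) (.and (.lt (.snd (.snd (.fst .id))) (.snd (.snd .id)))
    (.and (.crossTest (lift hP) (lift hD) (lift hlo) (lift hhi) (lift hz) (.snd (.fst .id))
      (.snd .id)) (.and (.lt (.snd (lift hz)) (.snd (.snd .id))) (.and (.all (lift hP) ?_)
        (.all (lift hP) (.all ((lift hP).comp (.fst .id)) ?_)))))))
  · exact .or (.not (.sameBlock ((lift hP).comp (.fst .id)) ((lift hlo).comp (.fst .id))
      (.fst (.snd .id)) (.fst ((lift hz).comp (.fst .id)))))
      (.or (.not (.lt (.snd (.snd .id)) (.snd (.snd (.fst .id)))))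
        (.le (.snd (.snd .id)) (.snd ((lift hz).comp (.fst .id)))))
  · have lift' : ∀ {α : Type} [Enc α] {f : E → α}, PTime f →
        PTime fun x : (((E × (ℤ × ℤ)) × (ℤ × ℤ)) × (ℤ × ℤ)) × (ℤ × ℤ) => f x.1.1.1.1 :=
      fun hf => hf.comp (.fst (.fst (.fst (.fst .id))))
    exact .or (.not (.le (.snd (.snd (.fst (.fst (.fst .id))))) (.snd (.snd (.fst .id)))))
      (.or (.not (.lt (.snd (.snd (.fst .id))) (.snd (.snd .id))))
        (.or (.not (.lt (.snd (.snd .id)) (.snd (.snd (.fst (.fst .id))))))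
          (.not (.crossTest (lift' hP) (lift' hD) (lift' hlo) (lift' hhi) (lift' hz)
            (.snd (.fst .id)) (.snd .id)))))

theorem PTime.boundaryTest {P : E → List (ℤ × ℤ)} {m : E → ℤ} {z i : E → ℤ × ℤ} (hP : PTime P)
    (hm : PTime m) (hz : PTime z) (hi : PTime i) :
    PTime fun e => boundaryTest (P e) (m e) (z e) (i e) := by
  have lift : ∀ {α : Type} [Enc α] {f : E → α}, PTime f →
      PTime fun x : E × (ℤ × ℤ) => f x.1 := fun hf => hf.comp (.fst .id)
  have hj : PTime fun x : E × (ℤ × ℤ) => x.2.1 := .fst (.snd .id)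
  exact .or (.and (.sameBlock hP hm hi.fst hz.fst)
      (.all hP (.or (.not (.sameBlock (lift hP) (lift hm) hj (lift hz).fst)) (.le hj (lift hi).fst))))
    (.or (.and (.sameBlock hP hm hi.fst hz.fst)
      (.all hP (.or (.not (.sameBlock (lift hP) (lift hm) hj (lift hz).fst)) (.le (lift hi).fst hj))))
    (.or (.and (.blockLt hP hm hz.fst hi.fst)
      (.all hP (.or (.not (.blockLt (lift hP) (lift hm) (lift hz).fst hj)) (.le (lift hi).fst hj))))
    (.and (.blockLt hP hm hi.fst hz.fst)
      (.all hP (.or (.not (.blockLt (lift hP) (lift hm) hj (lift hz).fst)) (.le hj (lift hi).fst))))))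

theorem PTime.levelPoints {P : E → List (ℤ × ℤ)} {D : E → List ((ℤ × ℤ) × (ℤ × ℤ))}
    {A' A : E → List ℤ} (hP : PTime P) (hD : PTime D) (hA' : PTime A') (hA : PTime A) :
    PTime fun e => levelPoints (P e) (D e) (A' e) (A e) := by
  refine .flatMap hA (.flatMap (.filter (hA.comp (.fst .id)) (.and (.lt (.snd (.fst .id)) (.snd .id))
    (.all (hA.comp (.fst (.fst .id))) (.or (.le (.snd .id) (.snd (.fst (.fst .id))))
      (.le (.snd (.fst .id)) (.snd .id))))))
    (.flatMap (.filter (hA'.comp (.fst (.fst .id))) (.and (.le (.snd (.fst (.fst .id))) (.snd .id))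
      (.lt (.snd .id) (.snd (.fst .id)))))
    (.flatMap (.filter (hP.comp (.fst (.fst (.fst .id)))) ?_)
    (.map (.filter (hP.comp (.fst (.fst (.fst (.fst .id))))) ?_)
      (.pair (.fst (.snd .id)) (.snd (.snd (.fst .id))))))))
  · exact .keyTest (hP.comp (.fst (.fst (.fst (.fst .id))))) (hD.comp (.fst (.fst (.fst (.fst .id)))))
      (.snd (.fst (.fst (.fst .id)))) (.snd (.fst (.fst .id))) (.snd .id)
  · exact .boundaryTest (hP.comp (.fst (.fst (.fst (.fst (.fst .id))))))
      (.snd (.fst (.fst .id))) (.snd (.fst .id)) (.snd .id)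

theorem PTime.thin {A : E → List ℤ} (hA : PTime A) : PTime fun e => thin (A e) := by
  refine .filter hA ?_
  exact PTime.foldl_of_sz_le (E := E × ℤ) (l := fun x => A x.1)
    (g := fun x acc y => bif decide (y < x.2) then !acc else acc) 2
    (.cond (.lt (.snd (.snd .id)) (.snd (.fst .id))) (.not (.fst (.snd .id))) (.fst (.snd .id)))
    (.const true) (hA.comp (.fst .id)) sz_bool

theorem PTime.len {P : E → List (ℤ × ℤ)} (hP : PTime P) : PTime fun e => len (P e) := by
  refine PTime.foldl_of_growth (g := fun _ acc _ => acc + 1) (.add (.fst (.snd .id)) (.const 1))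
    (.const 0) hP ⟨.C 3, fun e acc p => ?_⟩
  have := sz_add_le acc 1
  rw [sz_one_int] at this
  rw [Polynomial.eval_C]
  omega

theorem PTime.sizeBound {P : E → List (ℤ × ℤ)} (hP : PTime P) :
    PTime fun e => sizeBound (P e) := by
  have hlen := PTime.len hP
  obtain ⟨q, hq⟩ := hlen.size_le
  refine PTime.foldl_of_growth (g := fun e acc _ => acc + Manhattan.len (P e))
    (.add (.fst (.snd .id)) (hlen.comp (.fst .id))) (.const 1) hP ⟨q + 1, fun e acc p => ?_⟩
  have h1 := sz_add_le acc (Manhattan.len (P e))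
  have h2 := hq e
  rw [Polynomial.eval_add, Polynomial.eval_one]
  omega

theorem foldl_double {ι : Type} (l : List ι) :
    l.foldl (fun (acc : ℤ × List ℤ) _ => (acc.1 + acc.1, acc.1 :: acc.2)) (1, []) =
      (2 ^ l.length, (List.range l.length).reverse.map fun j => 2 ^ j) := by
  induction l using List.reverseRecOn with
  | nil => simp
  | append_singleton l a ih =>
    rw [List.foldl_append, ih]
    simp [List.range_succ, pow_succ, mul_two]

theorem sz_two_pow (j : ℕ) : sz ((2 : ℤ) ^ j) = j + 2 := by
  rw [sz_int, Int.natAbs_pow]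
  change 1 + (2 ^ j).size = _
  rw [Nat.size_pow]
  omega

/-- The growth per round depends on the accumulator here; instead the closed form `foldl_double` is
used, with `2 ^ j` taking only `j + 2` units of size. -/
theorem PTime.powers {P : E → List (ℤ × ℤ)} (hP : PTime P) : PTime fun e => powers (P e) := by
  have hF : PTime fun e => (0, 0) :: (P e ++ P e) := .cons (.const (0, 0)) (hP.append hP)
  obtain ⟨r, hr⟩ := hF.size_le
  refine .filter (.snd ?_) (.le (.snd .id) ((PTime.sizeBound hP).comp (.fst .id)))
  refine PTime.foldl (g := fun _ acc _ => (acc.1 + acc.1, acc.1 :: acc.2))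
    (.pair (.add (.fst (.fst (.snd .id))) (.fst (.fst (.snd .id))))
      (.cons (.fst (.fst (.snd .id))) (.snd (.fst (.snd .id))))) (.const (1, [])) hF
    ⟨1 + (r + 2) + (1 + r * (1 + (r + 2))), fun e l' hl' => ?_⟩
  have h1 : l'.length ≤ r.eval (sz e) := hl'.length_le.trans ((length_le_sz _).trans (hr e))
  have h4 : Polynomial.eval (sz e) (2 : Polynomial ℕ) = 2 := by simp
  rw [foldl_double, sz_pair, sz_two_pow]
  simp only [Polynomial.eval_add, Polynomial.eval_mul, Polynomial.eval_one, h4]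
  have h2 : sz ((List.range l'.length).reverse.map fun j => (2 : ℤ) ^ j) ≤
      1 + l'.length * (1 + (r.eval (sz e) + 2)) := by
    refine (sz_le_of_forall (B := r.eval (sz e) + 2) fun a ha => ?_).trans (by simp)
    simp only [List.mem_map, List.mem_reverse, List.mem_range] at ha
    obtain ⟨j, hj, rfl⟩ := ha
    rw [sz_two_pow]
    omega
  have h3 := Nat.mul_le_mul_right (1 + (r.eval (sz e) + 2)) h1
  omega

theorem sz_filter_le (f : α → Bool) (l : List α) : sz (l.filter f) ≤ sz l := by
  induction l with
  | nil => simp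
  | cons a l ih =>
    cases h : f a
    · rw [List.filter_cons_of_neg (by simp [h]), sz_cons]; omega
    · rw [List.filter_cons_of_pos h, sz_cons, sz_cons]; omega

/-- Thinning never enlarges a scale, so every round appends a list whose size is bounded in terms of
the input alone. -/
theorem PTime.keyPoints {P : E → List (ℤ × ℤ)} {D : E → List ((ℤ × ℤ) × (ℤ × ℤ))} (hP : PTime P)
    (hD : PTime D) : PTime fun e => keyPoints (P e) (D e) := by
  have hA := PTime.powers hP
  obtain ⟨r, hr⟩ := hA.size_le
  obtain ⟨q, hq⟩ := (PTime.levelPoints (E := E × (List ℤ × List ℤ)) (hP.comp (.fst .id))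
    (hD.comp (.fst .id)) (.fst (.snd .id)) (.snd (.snd .id))).size_le
  refine .snd (.snd (PTime.foldl (g := fun e acc _ => levelStep (P e) (D e) acc) ?_
    (.pair hA (.pair hA (.const []))) hA
    ⟨1 + r + (1 + r + (1 + r * q.comp (1 + .X + (1 + r + r)))), fun e l' hl' => ?_⟩))
  · exact .pair (.fst (.snd (.fst (.snd .id)))) (.pair (.thin (.fst (.snd (.fst (.snd .id)))))
      (.append (.snd (.snd (.fst (.snd .id)))) (.levelPoints (hP.comp (.fst .id))
        (hD.comp (.fst .id)) (.fst (.fst (.snd .id))) (.fst (.snd (.fst (.snd .id)))))))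
  · have h : ∀ l' : List ℤ, ∀ acc, acc = l'.foldl (fun acc _ => levelStep (P e) (D e) acc)
        (Manhattan.powers (P e), (Manhattan.powers (P e), [])) →
        sz acc.1 ≤ r.eval (sz e) ∧ sz acc.2.1 ≤ r.eval (sz e) ∧ sz acc.2.2 ≤
          1 + l'.length * q.eval (1 + sz e + (1 + r.eval (sz e) + r.eval (sz e))) := by
      intro l'
      induction l' using List.reverseRecOn with
      | nil =>
        rintro acc rfl
        exact ⟨hr e, hr e, by simp [sz_nil]⟩
      | append_singleton l' a ih =>
        rintro acc rfl
        obtain ⟨h1, h2, h3⟩ := ih _ rfl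
        rw [List.foldl_append]
        simp only [List.foldl_cons, List.foldl_nil, List.length_append, List.length_singleton,
          Nat.succ_mul]
        set acc := l'.foldl (fun acc _ => levelStep (P e) (D e) acc)
          (Manhattan.powers (P e), (Manhattan.powers (P e), []))
        refine ⟨h2, (sz_filter_le _ _).trans h2, ?_⟩
        have h4 := sz_append acc.2.2 (Manhattan.levelPoints (P e) (D e) acc.1 acc.2.1)
        have h5 := hq (e, (acc.1, acc.2.1))
        have h6 := polynomial_eval_mono q (show sz (e, (acc.1, acc.2.1)) ≤
          1 + sz e + (1 + r.eval (sz e) + r.eval (sz e)) by simp only [sz_pair]; omega)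
        dsimp only at h5
        simp only [levelStep]
        omega
    obtain ⟨h1, h2, h3⟩ := h l' _ rfl
    have h4 : l'.length ≤ r.eval (sz e) := hl'.length_le.trans ((length_le_sz _).trans (hr e))
    have h5 := Nat.mul_le_mul_right (q.eval (1 + sz e + (1 + r.eval (sz e) + r.eval (sz e)))) h4
    simp only [Polynomial.eval_add, Polynomial.eval_mul, Polynomial.eval_one, Polynomial.eval_comp,
      Polynomial.eval_X, sz_pair]
    omega

theorem PTime.negRow {p : E → ℤ × ℤ} (hp : PTime p) : PTime fun e => negRow (p e) :=
  .pair hp.fst (.sub (.const 0) hp.snd)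

theorem pTime_algorithm : PTime algorithm :=
  .append (.keyPoints (.fst .id) (.snd .id))
    (.map (.keyPoints (.map (.fst .id) (.negRow (.snd .id)))
      (.map (.snd .id) (.pair (.negRow (.fst (.snd .id))) (.negRow (.snd (.snd .id))))))
      (.negRow (.snd .id)))

end Time

end Manhattan

namespace Manhattan

/-! ### Correctness of the algorithm -/

theorem rank_eq (P : List (ℤ × ℤ)) (x : ℤ) :
    rank P x = ((P.countP fun p => decide (p.1 < x) : ℕ) : ℤ) := by
  have h : ∀ (l : List (ℤ × ℤ)) (b : ℤ),
      l.foldl (fun acc p => bif decide (p.1 < x) then acc + 1 else acc) b =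
        b + ((l.countP fun p => decide (p.1 < x) : ℕ) : ℤ) := by
    intro l
    induction l with
    | nil => simp
    | cons a l ih =>
      intro b
      rw [List.foldl_cons, ih]
      by_cases ha : a.1 < x
      · simp only [ha, decide_true, cond_true, List.countP_cons, if_true]
        push_cast
        ring
      · simp [ha]
  simpa [rank] using h P 0

/-- Each list entry allows one subtraction, so the fold computes the minimum of the list length and
`r / u`; the bound on `r` makes the list long enough. -/
theorem quot_eq (P : List (ℤ × ℤ)) {r u : ℕ} (hu : 0 < u) (hr : r ≤ P.length) :
    quot P r u = ((r / u : ℕ) : ℤ) := by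
  have h : ∀ (l : List (ℤ × ℤ)) (r : ℕ) (b : ℤ),
      (l.foldl (fun (acc : ℤ × ℤ) _ =>
        bif decide ((u : ℤ) ≤ acc.1) then (acc.1 - u, acc.2 + 1) else acc) ((r : ℤ), b)).2 =
        b + ((min l.length (r / u) : ℕ) : ℤ) := by
    intro l
    induction l with
    | nil => simp
    | cons a l ih =>
      intro r b
      rw [List.foldl_cons]
      by_cases hur : u ≤ r
      · have h1 : r / u = (r - u) / u + 1 := Nat.div_eq_sub_div hu hur
        have h2 : ((r : ℤ) - u) = ((r - u : ℕ) : ℤ) := by omega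
        simp only [Nat.cast_le, hur, decide_true, cond_true]
        rw [h2, ih, h1, List.length_cons]
        push_cast
        rw [min_add_add_right]
        ring
      · have h1 : r / u = 0 := Nat.div_eq_of_lt (by omega)
        simp only [Nat.cast_le, hur, decide_false, cond_false]
        rw [ih, h1]
        simp
  have h1 := h P r 0
  rw [min_eq_right ((Nat.div_le_self r u).trans hr), zero_add] at h1
  exact h1

theorem quot_rank (P : List (ℤ × ℤ)) (x : ℤ) (s : ℕ) :
    quot P (rank P x) (2 ^ s) = (((P.countP fun p => decide (p.1 < x)) / 2 ^ s : ℕ) : ℤ) := by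
  have := quot_eq P (u := 2 ^ s) (by positivity)
    (List.countP_le_length (p := fun p : ℤ × ℤ => decide (p.1 < x)) (l := P))
  rw [rank_eq]
  exact_mod_cast this

theorem pointEq_iff {p q : ℤ × ℤ} : pointEq p q = true ↔ p = q := by
  simp [pointEq, Prod.ext_iff]

theorem isDemand_iff {D : List ((ℤ × ℤ) × (ℤ × ℤ))} {p q : ℤ × ℤ} :
    isDemand D p q = true ↔ (p, q) ∈ D ∨ (q, p) ∈ D := by
  simp only [isDemand, List.any_eq_true, Bool.or_eq_true, Bool.and_eq_true, pointEq_iff]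
  constructor
  · rintro ⟨⟨a, b⟩, h, ⟨rfl, rfl⟩ | ⟨rfl, rfl⟩⟩
    · exact .inl h
    · exact .inr h
  · rintro (h | h)
    · exact ⟨_, h, .inl ⟨rfl, rfl⟩⟩
    · exact ⟨_, h, .inr ⟨rfl, rfl⟩⟩

/-- `L` is the layout of the points `P` and the demands `D`, with blocks given by the ranks. -/
structure Represents {ι κ : Type} (L : Layout ι κ) (P : List (ℤ × ℤ))
    (D : List ((ℤ × ℤ) × (ℤ × ℤ))) : Prop where
  mem : ∀ p, p ∈ P ↔ ∃ i, (L.X i, L.Y i) = p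
  blk : ∀ s i, L.blk s i = (((P.countP fun p => decide (p.1 < L.X i)) / 2 ^ s : ℕ) : ℤ)
  demand : ∀ i j, isDemand D (L.X i, L.Y i) (L.X j, L.Y j) = true ↔ L.c i ≠ L.c j

namespace Represents

variable {ι κ : Type} {L : Layout ι κ} {P : List (ℤ × ℤ)} {D : List ((ℤ × ℤ) × (ℤ × ℤ))}

theorem any_iff (h : Represents L P D) {f : ℤ × ℤ → Bool} :
    P.any f = true ↔ ∃ i, f (L.X i, L.Y i) = true := by
  simp only [List.any_eq_true, h.mem]
  constructor
  · rintro ⟨_, ⟨i, rfl⟩, hi⟩; exact ⟨i, hi⟩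
  · rintro ⟨i, hi⟩; exact ⟨_, ⟨i, rfl⟩, hi⟩

theorem all_iff (h : Represents L P D) {f : ℤ × ℤ → Bool} :
    P.all f = true ↔ ∀ i, f (L.X i, L.Y i) = true := by
  simp only [List.all_eq_true, h.mem]
  constructor
  · intro H i; exact H _ ⟨i, rfl⟩
  · rintro H _ ⟨i, rfl⟩; exact H i

theorem sameBlock_iff (h : Represents L P D) {s : ℕ} {i j : ι} :
    sameBlock P (2 ^ s) (L.X i) (L.X j) = true ↔ L.blk s i = L.blk s j := by
  simp only [sameBlock, quot_rank, decide_eq_true_iff, h.blk]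

theorem blockLt_iff (h : Represents L P D) {s : ℕ} {i j : ι} :
    blockLt P (2 ^ s) (L.X i) (L.X j) = true ↔ L.blk s i < L.blk s j := by
  simp only [blockLt, quot_rank, decide_eq_true_iff, h.blk]

theorem not_beq_iff {a b : Bool} : (!(a == b)) = true ↔ ¬(a = true ↔ b = true) := by
  cases a <;> cases b <;> simp

theorem crossTest_iff (h : Represents L P D) {lo hi : ℕ} {z s t : ι} :
    crossTest P D (2 ^ lo) (2 ^ hi) (L.X z, L.Y z) (L.X s, L.Y s) (L.X t, L.Y t) = true ↔
      L.Cross lo hi z s t := by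
  simp only [crossTest, Bool.and_eq_true, not_beq_iff, h.sameBlock_iff, h.demand, Layout.Cross]

theorem not_or_iff {a b : Bool} : (!a || b) = true ↔ (a = true → b = true) := by
  cases a <;> simp

theorem keyTest_iff (h : Represents L P D) {lo hi : ℕ} {z : ι} :
    keyTest P D (2 ^ lo) (2 ^ hi) (L.X z, L.Y z) = true ↔ L.UpKey lo hi z := by
  simp only [keyTest, h.any_iff, h.all_iff, Bool.and_eq_true, not_or_iff, decide_eq_true_iff,
    h.crossTest_iff, h.sameBlock_iff, Bool.not_eq_true', Layout.UpKey, Layout.UpKeyAt,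
    ← Bool.not_eq_true]

theorem boundaryTest_iff (h : Represents L P D) {m : ℕ} {z i : ι} :
    boundaryTest P (2 ^ m) (L.X z, L.Y z) (L.X i, L.Y i) = true ↔
      (L.blk m i = L.blk m z ∧ ∀ j, L.blk m j = L.blk m z → L.X j ≤ L.X i) ∨
      (L.blk m i = L.blk m z ∧ ∀ j, L.blk m j = L.blk m z → L.X i ≤ L.X j) ∨
      (L.blk m z < L.blk m i ∧ ∀ j, L.blk m z < L.blk m j → L.X i ≤ L.X j) ∨
      (L.blk m i < L.blk m z ∧ ∀ j, L.blk m j < L.blk m z → L.X j ≤ L.X i) := by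
  simp only [boundaryTest, h.all_iff, Bool.and_eq_true, Bool.or_eq_true (_ && _), not_or_iff,
    decide_eq_true_iff, h.sameBlock_iff, h.blockLt_iff]

theorem exists_boundaryTest_iff (h : Represents L P D) {m : ℕ} {z : ι} {x : ℤ} :
    (∃ i, boundaryTest P (2 ^ m) (L.X z, L.Y z) (L.X i, L.Y i) = true ∧ L.X i = x) ↔
      L.Bd m z x := by
  simp only [h.boundaryTest_iff, Layout.Bd, Layout.IsMax, Layout.IsMin, Layout.IsNext,
    Layout.IsPrev, ← exists_or]
  refine exists_congr fun i => ?_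
  constructor
  · rintro ⟨h, rfl⟩
    tauto
  · rintro (⟨rfl, h⟩ | ⟨rfl, h⟩ | ⟨rfl, h⟩ | ⟨rfl, h⟩) <;> tauto

end Represents

/-! ### Scales of block sizes -/

/-- `A` lists the block sizes of level `k` up to height `H`. -/
def IsScale (H k : ℕ) (A : List ℤ) : Prop :=
  A.Nodup ∧ ∀ u, u ∈ A ↔ ∃ i, i * 2 ^ k ≤ H ∧ u = 2 ^ (i * 2 ^ k)

theorem two_pow_mul_inj {k i j : ℕ} (h : (2 : ℤ) ^ (i * 2 ^ k) = 2 ^ (j * 2 ^ k)) : i = j :=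
  Nat.eq_of_mul_eq_mul_right (by positivity)
    (pow_right_injective₀ (by norm_num : (0 : ℤ) < 2) (by norm_num) h)

theorem two_pow_mul_lt {k i j : ℕ} : (2 : ℤ) ^ (i * 2 ^ k) < 2 ^ (j * 2 ^ k) ↔ i < j := by
  rw [pow_lt_pow_iff_right₀ (by norm_num : (1 : ℤ) < 2)]
  exact Nat.mul_lt_mul_right (by positivity)

theorem two_pow_mul_le {k i j : ℕ} : (2 : ℤ) ^ (i * 2 ^ k) ≤ 2 ^ (j * 2 ^ k) ↔ i ≤ j := by
  rw [pow_le_pow_iff_right₀ (by norm_num : (1 : ℤ) < 2)]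
  exact Nat.mul_le_mul_right_iff (by positivity)

theorem evenBelow_eq (A : List ℤ) (x : ℤ) :
    evenBelow A x = true ↔ Even (A.countP fun y => decide (y < x)) := by
  have h : ∀ (l : List ℤ) (b : Bool),
      l.foldl (fun acc y => bif decide (y < x) then !acc else acc) b = true ↔
        (Even (l.countP fun y => decide (y < x)) ↔ b = true) := by
    intro l
    induction l with
    | nil => simp
    | cons a l ih =>
      intro b
      rw [List.foldl_cons, ih]
      by_cases ha : a < x
      · cases b <;> simp [ha, Nat.even_add_one]
      · simp [ha]
  simpa [evenBelow] using h A true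

theorem IsScale.countP {H k : ℕ} {A : List ℤ} (h : IsScale H k A) {i : ℕ} (hi : i * 2 ^ k ≤ H) :
    A.countP (fun y => decide (y < 2 ^ (i * 2 ^ k))) = i := by
  classical
  rw [List.countP_eq_length_filter, ← List.toFinset_card_of_nodup (h.1.filter _)]
  have : (A.filter fun y => decide (y < 2 ^ (i * 2 ^ k))).toFinset =
      (Finset.range i).image fun j => (2 : ℤ) ^ (j * 2 ^ k) := by
    ext u
    simp only [List.mem_toFinset, List.mem_filter, h.2, decide_eq_true_iff, Finset.mem_image,
      Finset.mem_range]
    constructor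
    · rintro ⟨⟨j, hj, rfl⟩, hlt⟩
      exact ⟨j, two_pow_mul_lt.1 hlt, rfl⟩
    · rintro ⟨j, hj, rfl⟩
      exact ⟨⟨j, (Nat.mul_le_mul_right _ hj.le).trans hi, rfl⟩, two_pow_mul_lt.2 hj⟩
  rw [this, Finset.card_image_of_injective _ fun a b => two_pow_mul_inj, Finset.card_range]

/-- The entry `2 ^ (i * 2 ^ k)` has exactly `i` smaller entries, and the even `i` give the multiples
of `2 ^ (k + 1)`. -/
theorem IsScale.thin {H k : ℕ} {A : List ℤ} (h : IsScale H k A) : IsScale H (k + 1) (thin A) := by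
  refine ⟨h.1.filter _, fun u => ?_⟩
  simp only [Manhattan.thin, List.mem_filter, h.2, evenBelow_eq]
  constructor
  · rintro ⟨⟨i, hi, rfl⟩, he⟩
    rw [h.countP hi] at he
    obtain ⟨j, rfl⟩ := he
    have e : (j + j) * 2 ^ k = j * 2 ^ (k + 1) := by ring
    exact ⟨j, e ▸ hi, by rw [e]⟩
  · rintro ⟨j, hj, rfl⟩
    have e : j * 2 ^ (k + 1) = (j + j) * 2 ^ k := by ring
    rw [e] at hj ⊢
    exact ⟨⟨j + j, hj, rfl⟩, by rw [h.countP hj]; exact ⟨j, rfl⟩⟩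

theorem len_eq (P : List (ℤ × ℤ)) : len P = P.length := by
  have h : ∀ (l : List (ℤ × ℤ)) (b : ℤ), l.foldl (fun acc _ => acc + 1) b = b + l.length := by
    intro l
    induction l with
    | nil => simp
    | cons a l ih => intro b; rw [List.foldl_cons, ih, List.length_cons]; push_cast; ring
  simpa [len] using h P 0

theorem sizeBound_eq (P : List (ℤ × ℤ)) : sizeBound P = ((P.length ^ 2 + 1 : ℕ) : ℤ) := by
  have h : ∀ (l : List (ℤ × ℤ)) (b : ℤ),
      l.foldl (fun acc _ => acc + len P) b = b + l.length * P.length := by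
    intro l
    induction l with
    | nil => simp
    | cons a l ih =>
      intro b; rw [List.foldl_cons, ih, List.length_cons, len_eq]; push_cast; ring
  rw [sizeBound, h]
  push_cast
  ring

/-- The number of heights used for `n` points. -/
def height (n : ℕ) : ℕ := Nat.log 2 (n ^ 2 + 1)

theorem le_height_iff {n j : ℕ} : j ≤ height n ↔ 2 ^ j ≤ n ^ 2 + 1 :=
  Nat.le_log_iff_pow_le (by norm_num) (by omega)

theorem height_le (n : ℕ) : height n ≤ 2 * n := by
  by_contra! h
  have h1 := le_height_iff.1 (Nat.succ_le_of_lt h)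
  have h2 : n + 1 ≤ 2 ^ n := Nat.lt_two_pow_self
  have h3 : 2 ^ (2 * n + 1) = 2 * (2 ^ n) ^ 2 := by ring
  have h4 := Nat.pow_le_pow_left h2 2
  have h5 : (n + 1) ^ 2 = n ^ 2 + 2 * n + 1 := by ring
  rw [Nat.succ_eq_add_one, h3] at h1
  omega

theorem isScale_powers (P : List (ℤ × ℤ)) : IsScale (height P.length) 0 (powers P) := by
  have e : powers P = ((List.range (2 * P.length + 1)).reverse.map fun j => (2 : ℤ) ^ j).filter
      fun u => decide (u ≤ sizeBound P) := by
    rw [powers, foldl_double]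
    simp [two_mul]
  rw [e]
  refine ⟨?_, fun u => ?_⟩
  · refine List.Nodup.filter _ (List.Nodup.map ?_ (List.nodup_reverse.2 List.nodup_range))
    exact pow_right_injective₀ (by norm_num : (0 : ℤ) < 2) (by norm_num)
  · simp only [List.mem_filter, List.mem_map, List.mem_reverse, List.mem_range, decide_eq_true_iff,
      sizeBound_eq, pow_zero, mul_one]
    constructor
    · rintro ⟨⟨j, -, rfl⟩, hj⟩
      exact ⟨j, le_height_iff.2 (by exact_mod_cast hj), rfl⟩
    · rintro ⟨j, hj, rfl⟩
      have := height_le P.length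
      exact ⟨⟨j, by omega, rfl⟩, by exact_mod_cast le_height_iff.1 hj⟩

/-- The scale of level `k - 1` meets an interval of level `k` in its lower end and its midpoint. For
`k = 0` the subtraction truncates and `2 ^ 0 / 2 = 0`, so both coincide. -/
theorem mid_iff {k i j : ℕ} :
    (i * 2 ^ k ≤ j * 2 ^ (k - 1) ∧ j * 2 ^ (k - 1) < (i + 1) * 2 ^ k) ↔
      (j * 2 ^ (k - 1) = i * 2 ^ k ∨ j * 2 ^ (k - 1) = i * 2 ^ k + 2 ^ k / 2) := by
  cases k with
  | zero => simp; omega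
  | succ k =>
    have hpos : 0 < 2 ^ k := by positivity
    have e1 : i * 2 ^ (k + 1) = (2 * i) * 2 ^ k := by ring
    have e2 : (i + 1) * 2 ^ (k + 1) = (2 * i + 2) * 2 ^ k := by ring
    have e3 : 2 ^ (k + 1) / 2 = 2 ^ k := by rw [pow_succ]; omega
    have e4 : 2 * i * 2 ^ k + 2 ^ k = (2 * i + 1) * 2 ^ k := by ring
    rw [Nat.add_sub_cancel, e3, e1, e2, e4, Nat.mul_le_mul_right_iff hpos,
      Nat.mul_lt_mul_right hpos, Nat.mul_right_cancel_iff hpos, Nat.mul_right_cancel_iff hpos]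
    omega

namespace Represents

variable {ι κ : Type} {L : Layout ι κ} {P : List (ℤ × ℤ)} {D : List ((ℤ × ℤ) × (ℤ × ℤ))}

theorem mem_levelPoints_iff (h : Represents L P D) {H k : ℕ} {A' A : List ℤ}
    (hA' : IsScale H (k - 1) A') (hA : IsScale H k A) {p : ℤ × ℤ} :
    p ∈ levelPoints P D A' A ↔ p ∈ L.levelSet H k := by
  simp only [levelPoints, List.mem_flatMap, List.mem_filter, List.mem_map, Bool.and_eq_true,
    List.all_eq_true, Bool.or_eq_true, decide_eq_true_iff]
  constructor
  · rintro ⟨lo, hlo, hi, ⟨hhi, hlt, hbet⟩, m, ⟨hm, hlm, hmh⟩, z, ⟨hz, hkey⟩, i, ⟨hi, hbd⟩, rfl⟩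
    obtain ⟨a, ha, rfl⟩ := (hA.2 _).1 hlo
    obtain ⟨b, hb, rfl⟩ := (hA.2 _).1 hhi
    obtain ⟨j, hj, rfl⟩ := (hA'.2 _).1 hm
    obtain ⟨z, rfl⟩ := (h.mem _).1 hz
    obtain ⟨i, rfl⟩ := (h.mem _).1 hi
    have hab := two_pow_mul_lt.1 hlt
    have hba : b = a + 1 := by
      have h1 : (a + 1) * 2 ^ k ≤ H := (Nat.mul_le_mul_right _ hab).trans hb
      have h2 := hbet _ ((hA.2 _).2 ⟨a + 1, h1, rfl⟩)
      rw [two_pow_mul_le, two_pow_mul_le] at h2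
      omega
    subst hba
    refine ⟨a, hb, z, h.keyTest_iff.1 hkey, j * 2 ^ (k - 1), mid_iff.1 ⟨?_, ?_⟩,
      h.exists_boundaryTest_iff.1 ⟨i, hbd, rfl⟩, rfl⟩
    · exact (pow_le_pow_iff_right₀ (by norm_num : (1 : ℤ) < 2)).1 hlm
    · exact (pow_lt_pow_iff_right₀ (by norm_num : (1 : ℤ) < 2)).1 hmh
  · rintro ⟨a, ha, z, hz, m, hm, hbd, hy⟩
    obtain ⟨i, hi, hx⟩ := h.exists_boundaryTest_iff.2 hbd
    have hle : a * 2 ^ k ≤ H := (Nat.mul_le_mul_right _ (Nat.le_succ a)).trans ha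
    obtain ⟨j, rfl⟩ : ∃ j, m = j * 2 ^ (k - 1) := by
      cases k with
      | zero => exact ⟨m, by simp⟩
      | succ k =>
        have e3 : 2 ^ (k + 1) / 2 = 2 ^ k := by rw [pow_succ]; omega
        rw [e3] at hm
        rcases hm with rfl | rfl
        · exact ⟨2 * a, by rw [Nat.add_sub_cancel]; ring⟩
        · exact ⟨2 * a + 1, by rw [Nat.add_sub_cancel]; ring⟩
    have hm' := mid_iff.2 hm
    refine ⟨_, (hA.2 _).2 ⟨a, hle, rfl⟩, _, ⟨(hA.2 _).2 ⟨a + 1, ha, rfl⟩,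
      two_pow_mul_lt.2 (Nat.lt_succ_self a), fun w hw => ?_⟩, _,
      ⟨(hA'.2 _).2 ⟨j, hm'.2.le.trans ha, rfl⟩, ?_, ?_⟩, (L.X z, L.Y z),
      ⟨(h.mem _).2 ⟨z, rfl⟩, h.keyTest_iff.2 hz⟩, (L.X i, L.Y i), ⟨(h.mem _).2 ⟨i, rfl⟩, hi⟩, ?_⟩
    · obtain ⟨b, -, rfl⟩ := (hA.2 _).1 hw
      rw [two_pow_mul_le, two_pow_mul_le]
      omega
    · exact pow_le_pow_right₀ (by norm_num) hm'.1
    · exact pow_lt_pow_right₀ (by norm_num) hm'.2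
    · exact Prod.ext hx hy.symm

/-- Starting with the same scale twice agrees with the truncated `l.length - 1` at length `0`. -/
theorem foldl_levelStep (h : Represents L P D) {H : ℕ} {A : List ℤ} (hA : IsScale H 0 A)
    (l : List ℤ) (acc : List ℤ × (List ℤ × List (ℤ × ℤ)))
    (hacc : acc = l.foldl (fun acc _ => levelStep P D acc) (A, (A, []))) :
    IsScale H (l.length - 1) acc.1 ∧ IsScale H l.length acc.2.1 ∧
      ∀ p, p ∈ acc.2.2 ↔ ∃ k < l.length, p ∈ L.levelSet H k := by
  induction l using List.reverseRecOn generalizing acc with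
  | nil => subst hacc; exact ⟨hA, hA, by simp⟩
  | append_singleton l a ih =>
    obtain ⟨h1, h2, h3⟩ := ih _ rfl
    rw [List.foldl_append] at hacc
    generalize l.foldl (fun acc _ => levelStep P D acc) (A, (A, [])) = acc' at *
    subst hacc
    simp only [List.foldl_cons, List.foldl_nil, List.length_append, List.length_singleton,
      Nat.add_sub_cancel, levelStep]
    refine ⟨h2, h2.thin, fun p => ?_⟩
    rw [List.mem_append, h3, h.mem_levelPoints_iff h1 h2]
    simp only [Nat.lt_succ_iff_lt_or_eq, or_and_right, exists_or, exists_eq_left]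

theorem mem_keyPoints_iff (h : Represents L P D) {p : ℤ × ℤ} :
    p ∈ keyPoints P D ↔ ∃ k, p ∈ L.levelSet (height P.length) k := by
  classical
  have hA := isScale_powers P
  rw [keyPoints, (h.foldl_levelStep hA _ _ rfl).2.2]
  refine exists_congr fun k => and_iff_right_of_imp ?_
  rintro ⟨i, hi, -⟩
  -- A nonempty level has `k < 2 ^ k ≤ H`, and the list of powers provides at least `H` rounds.
  have h1 : k < height P.length :=
    Nat.lt_two_pow_self.trans_le ((Nat.le_mul_of_pos_left _ (Nat.succ_pos i)).trans hi)
  have h2 := hA.countP (i := height P.length) (by simp)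
  exact h1.trans_le (h2.symm.le.trans List.countP_le_length)

theorem flipY (h : Represents L P D) :
    Represents L.flipY (P.map fun p => negRow p)
      (D.map fun d => (negRow d.1, negRow d.2)) where
  mem p := by
    simp only [List.mem_map, h.mem]
    constructor
    · rintro ⟨_, ⟨i, rfl⟩, rfl⟩
      exact ⟨i, by simp [Layout.flipY, negRow]⟩
    · rintro ⟨i, rfl⟩
      exact ⟨_, ⟨i, rfl⟩, by simp [Layout.flipY, negRow]⟩
  blk s i := by
    rw [List.countP_map]
    exact h.blk s i
  demand i j := by
    have hinj : ∀ p q, negRow p = negRow q ↔ p = q := by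
      intro p q
      simp [negRow, Prod.ext_iff]
    have e : ∀ i, (L.flipY.X i, L.flipY.Y i) = negRow (L.X i, L.Y i) := by
      simp [Layout.flipY, negRow]
    have key : ∀ p q, (negRow p, negRow q) ∈ D.map (fun d => (negRow d.1, negRow d.2)) ↔
        (p, q) ∈ D := by
      intro p q
      simp only [List.mem_map, Prod.mk.injEq, hinj]
      constructor
      · rintro ⟨d, hd, rfl, rfl⟩; exact hd
      · intro hd; exact ⟨_, hd, rfl, rfl⟩
    rw [isDemand_iff, e, e, key, key, ← isDemand_iff]
    exact h.demand i j

end Represents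

/-- The layout of an instance with complete multipartite demands. -/
theorem Instance.IsCompletePartite.exists_layout {I : Instance} {k : ℕ}
    (h : I.IsCompletePartite k) :
    ∃ L : Layout {p // p ∈ I.points} (Fin k),
      (∀ i, (L.X i, L.Y i) = i.1) ∧ Represents L I.points I.demands := by
  obtain ⟨S, hdisj, hmem, hdem⟩ := h
  choose c hc using fun i : {p // p ∈ I.points} => (hmem i.1).1 i.2
  have huniq : ∀ (i : {p // p ∈ I.points}) a, i.1 ∈ S a → a = c i := by
    intro i a ha
    by_contra hne
    exact Set.disjoint_left.1 (hdisj _ _ hne) ha (hc i)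
  set r : ℤ → ℕ := fun x => I.points.countP fun p => decide (p.1 < x) with hr
  have hrmono : ∀ x y, x ≤ y → r x ≤ r y := fun x y hxy =>
    List.countP_mono_left fun p _ hp => by
      simp only [decide_eq_true_iff] at hp ⊢
      omega
  -- The point `i` itself is counted for `y` but not for its own column.
  have hrstrict : ∀ (i : {p // p ∈ I.points}) y, i.1.1 < y → r i.1.1 < r y := by
    intro i y hy
    obtain ⟨l₁, l₂, hl⟩ := List.append_of_mem i.2
    have h1 : ∀ l : List GridPoint, l.countP (fun p => decide (p.1 < i.1.1)) ≤
        l.countP fun p => decide (p.1 < y) := fun l => List.countP_mono_left fun p _ hp => by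
      simp only [decide_eq_true_iff] at hp ⊢
      omega
    simp only [hr, hl, List.countP_append, List.countP_cons, hy, lt_irrefl, decide_true,
      decide_false, if_true]
    have := h1 l₁
    have := h1 l₂
    simp only [Bool.false_eq_true, if_false]
    omega
  refine ⟨{
    X := fun i => i.1.1
    Y := fun i => i.1.2
    c := c
    blk := fun s i => ((r i.1.1 / 2 ^ s : ℕ) : ℤ)
    Y_inj := fun i j hij => Subtype.ext (List.inj_on_of_nodup_map I.distinct_rows i.2 j.2 hij)
    mono := fun s i j hij => Int.ofNat_le.2 (Nat.div_le_div_right (hrmono _ _ hij))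
    nest := fun s i j hij => by
      have := Int.ofNat_inj.1 hij
      simp only [pow_succ, ← Nat.div_div_eq_div_mul, this]
    binary := fun s i j hij => by
      have := Int.ofNat_inj.1 hij
      simp only [pow_succ, ← Nat.div_div_eq_div_mul] at this
      omega
    zero := fun i j hij => by
      have hij := Int.ofNat_inj.1 hij
      simp only [pow_zero, Nat.div_one] at hij
      rcases lt_trichotomy i.1.1 j.1.1 with h | h | h
      · exact absurd hij (hrstrict i _ h).ne
      · exact h
      · exact absurd hij (hrstrict j _ h).ne' }, fun i => rfl, ?_, ?_, ?_⟩
  · exact fun p => ⟨fun hp => ⟨⟨p, hp⟩, rfl⟩, by rintro ⟨i, rfl⟩; exact i.2⟩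
  · exact fun s i => rfl
  · intro i j
    rw [isDemand_iff]
    refine (hdem i.1 j.1).trans ⟨?_, fun h => ⟨c i, c j, h, hc i, hc j⟩⟩
    rintro ⟨a, b, hab, ha, hb⟩
    rwa [huniq i a ha, huniq j b hb] at hab

/-! ### Number of levels and approximation ratio -/

/-- Rounding the height down to a power of two loses less than a factor `2`; the square in `height`
compensates for it. -/
theorem exists_top (n : ℕ) (hn : 1 ≤ n) : ∃ K, 2 ^ K ≤ height n ∧ n < 2 ^ 2 ^ K := by
  have hH : height n ≠ 0 := by
    have : 1 ≤ height n := le_height_iff.2 (by nlinarith)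
    omega
  refine ⟨Nat.log 2 (height n), Nat.pow_log_le_self 2 hH, ?_⟩
  have h1 : height n < 2 ^ (Nat.log 2 (height n) + 1) := Nat.lt_pow_succ_log_self (by norm_num) _
  have h2 : n ^ 2 + 1 < 2 ^ (height n + 1) := Nat.lt_pow_succ_log_self (by norm_num) _
  have h3 : (2 : ℕ) ^ (height n + 1) ≤ (2 ^ 2 ^ Nat.log 2 (height n)) ^ 2 := by
    rw [← pow_mul]
    exact Nat.pow_le_pow_right (by norm_num) (by rw [← pow_succ]; exact h1)
  exact lt_of_pow_lt_pow_left₀ 2 (by positivity) (by omega)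

theorem size_height_le (n : ℕ) :
    ((height n).size : ℝ) ≤ 9 * max 1 (Real.log (Real.log n)) := by
  have hmax : (1 : ℝ) ≤ max 1 (Real.log (Real.log n)) := le_max_left _ _
  rcases Nat.lt_or_ge n 2 with hn | hn
  · have : (height n).size ≤ 2 := by
      refine Nat.size_le.2 ((height_le n).trans_lt ?_)
      omega
    have : ((height n).size : ℝ) ≤ 2 := by exact_mod_cast this
    linarith
  · have hn' : (2 : ℝ) ≤ n := by exact_mod_cast hn
    have hl2 := Real.log_two_gt_d9
    have hlog : Real.log 2 ≤ Real.log n := Real.log_le_log (by norm_num) hn'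
    have hH : (height n : ℝ) * Real.log 2 ≤ 3 * Real.log n := by
      have h1 : (2 : ℝ) ^ height n ≤ (n : ℝ) ^ 2 + 1 := by
        exact_mod_cast le_height_iff.1 (le_refl (height n))
      have h2 : (n : ℝ) ^ 2 + 1 ≤ (n : ℝ) ^ 3 := by nlinarith
      have h3 := Real.log_le_log (by positivity) (h1.trans h2)
      rw [Real.log_pow, Real.log_pow] at h3
      exact_mod_cast h3
    have hpos : 1 ≤ height n := le_height_iff.2 (by nlinarith)
    obtain ⟨h, hh⟩ : ∃ h, (height n).size = h + 1 :=
      Nat.exists_eq_succ_of_ne_zero fun h0 => by have := Nat.size_eq_zero.1 h0; omega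
    have h4 : (2 : ℝ) ^ h ≤ height n := by
      exact_mod_cast Nat.lt_size.1 (by omega : h < (height n).size)
    -- Uses `3 / log 2 < 5`. Then `h * log 2 ≤ 4 + log (log n)` is at most `5` times the maximum,
    -- and `5 / log 2 + 1 < 9`.
    have h5 : (2 : ℝ) ^ h ≤ 5 * Real.log n := by nlinarith
    have h6 := Real.log_le_log (by positivity) h5
    rw [Real.log_pow, Real.log_mul (by norm_num) (by linarith)] at h6
    have h7 : Real.log 5 ≤ 5 - 1 := Real.log_le_sub_one_of_pos (by norm_num)
    have h8 : Real.log (Real.log n) ≤ max 1 (Real.log (Real.log n)) := le_max_right _ _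
    rw [hh]
    push_cast
    have h9 : (0 : ℝ) ≤ h := Nat.cast_nonneg h
    nlinarith

theorem Instance.exists_feasible_card_eq_opt (I : Instance) :
    ∃ Q : Finset (ℝ × ℝ), I.Feasible Q ∧ Q.card = I.opt :=
  Nat.sInf_mem (s := {m | ∃ Q : Finset (ℝ × ℝ), I.Feasible Q ∧ Q.card = m})
    (let ⟨Q, hQ⟩ := I.exists_feasible; ⟨_, Q, hQ, rfl⟩)

theorem feasible_algorithm {I : Instance} {k : ℕ} (h : I.IsCompletePartite k) :
    I.Feasible ((algorithm (I.points, I.demands)).map GridPoint.toPlane).toFinset := by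
  obtain ⟨L, hpos, hL⟩ := h.exists_layout
  intro d hd
  obtain ⟨hp, hq⟩ := I.demands_mem d hd
  set T : Set (ℤ × ℤ) := {p | p ∈ I.points ∨ p ∈ algorithm (I.points, I.demands)} with hT
  obtain ⟨K, hK, hn⟩ := exists_top I.points.length (List.length_pos_of_mem hp)
  have hc : L.c ⟨d.1, hp⟩ ≠ L.c ⟨d.2, hq⟩ := by
    rw [← hL.demand, hpos, hpos, isDemand_iff]
    exact .inl hd
  have h1 : L.Covers (height I.points.length) T :=
    Layout.covers_iff.2 fun k p hp => .inr (List.mem_append.2 (.inl (hL.mem_keyPoints_iff.2 ⟨k, hp⟩)))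
  have h2 : L.flipY.Covers (height I.points.length) {p | (p.1, -p.2) ∈ T} := by
    refine Layout.covers_iff.2 fun k p hp => .inr (List.mem_append.2 (.inr ?_))
    refine List.mem_map.2 ⟨p, hL.flipY.mem_keyPoints_iff.2 ⟨k, ?_⟩, by simp [negRow]⟩
    rwa [List.length_map]
  have key := Layout.mconnected_of_covers h1 h2 (fun i => .inl (by rw [hpos]; exact i.2)) hK ?_
    (X := {x | ∃ p ∈ I.points, p.toPlane = x} ∪
      (((algorithm (I.points, I.demands)).map GridPoint.toPlane).toFinset : Set (ℝ × ℝ))) ?_ hc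
  · simpa only [Layout.pos, hpos] using key
  -- All ranks are at most `n < 2 ^ 2 ^ K`, so at height `2 ^ K` there is only block `0`.
  · intro i j
    have h0 : ∀ i, L.blk (2 ^ K) i = 0 := fun i => by
      rw [hL.blk, Nat.div_eq_of_lt (List.countP_le_length.trans_lt hn), Nat.cast_zero]
    rw [h0, h0]
  · rintro t (ht | ht)
    · exact .inl ⟨t, ht, rfl⟩
    · refine .inr ?_
      rw [List.coe_toFinset]
      exact List.mem_map.2 ⟨t, ht, rfl⟩

theorem card_algorithm_le {I : Instance} {k : ℕ} (h : I.IsCompletePartite k) :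
    (((algorithm (I.points, I.demands)).map GridPoint.toPlane).toFinset.card) ≤
      (height I.points.length).size * (256 * I.opt) := by
  classical
  obtain ⟨L, hpos, hL⟩ := h.exists_layout
  obtain ⟨Q, hQ, hcard⟩ := I.exists_feasible_card_eq_opt
  have hrange : {x | ∃ p ∈ I.points, p.toPlane = x} = Set.range L.pos := by
    ext x
    constructor
    · rintro ⟨p, hp, rfl⟩
      exact ⟨⟨p, hp⟩, by rw [Layout.pos, hpos]⟩
    · rintro ⟨i, rfl⟩
      exact ⟨i.1, i.2, by rw [Layout.pos, hpos]⟩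
  have hLQ : L.Feasible Q := by
    intro i j hij
    rw [← hL.demand, hpos, hpos, isDemand_iff] at hij
    rw [← hrange, Layout.pos, Layout.pos, hpos, hpos]
    rcases hij with h | h
    · exact hQ _ h
    · exact (hQ _ h).symm
  obtain ⟨F, hF, hFc⟩ := Layout.exists_finset_levelSets hLQ (height I.points.length)
  obtain ⟨G, hG, hGc⟩ := Layout.exists_finset_levelSets hLQ.flipY (height I.points.length)
  have hGc' := hGc.trans (Nat.mul_le_mul_left _ (Nat.mul_le_mul_left _ Finset.card_image_le))
  have hsub : ((algorithm (I.points, I.demands)).map GridPoint.toPlane).toFinset ⊆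
      (F ∪ G.image fun p => negRow p).image GridPoint.toPlane := by
    intro x hx
    obtain ⟨p, hp, rfl⟩ := List.mem_map.1 (List.mem_toFinset.1 hx)
    refine Finset.mem_image_of_mem _ (Finset.mem_union.2 ?_)
    rcases List.mem_append.1 hp with hp | hp
    · obtain ⟨k, hk⟩ := hL.mem_keyPoints_iff.1 hp
      exact .inl (hF k hk)
    · obtain ⟨q, hq, rfl⟩ := List.mem_map.1 hp
      obtain ⟨k, hk⟩ := hL.flipY.mem_keyPoints_iff.1 hq
      rw [List.length_map] at hk
      exact .inr (Finset.mem_image_of_mem _ (hG k hk))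
  calc _ ≤ F.card + G.card := (Finset.card_le_card hsub).trans (Finset.card_image_le.trans
        ((Finset.card_union_le _ _).trans (Nat.add_le_add_left Finset.card_image_le _)))
    _ ≤ _ := Nat.add_le_add hFc hGc'
    _ = _ := by rw [hcard]; ring

end Manhattan

theorem theorem4 :
    ∃ (C : ℝ) (A : Manhattan.Program),
      Manhattan.IsApproxAlgorithm A
        (fun I => ∃ k : ℕ, I.IsCompletePartite k)
        (fun n => C * max 1 (Real.log (Real.log (n : ℝ)))) := by
  obtain ⟨A, p, hA⟩ := Manhattan.pTime_algorithm
  -- `2304 = 9 * 256`: `9` from `size_height_le`, and `256 = 2 * 128` for the instance and its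
  -- reflection.
  refine ⟨2304, A, p, ?_⟩
  rintro I ⟨k, hI⟩
  obtain ⟨t, ht, htp⟩ := hA (I.points, I.demands)
  refine ⟨_, t, ht, htp, Manhattan.feasible_algorithm hI, ?_⟩
  have h1 : (((Manhattan.algorithm (I.points, I.demands)).map
      Manhattan.GridPoint.toPlane).toFinset.card : ℝ) ≤
      (Manhattan.height I.points.length).size * (256 * I.opt) := by
    exact_mod_cast Manhattan.card_algorithm_le hI
  have h2 := mul_le_mul_of_nonneg_right (Manhattan.size_height_le I.points.length)
    (by positivity : (0 : ℝ) ≤ 256 * I.opt)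
  calc _ ≤ _ := h1.trans h2
    _ = _ := by ring
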